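/- Let $E_1,E_2$ be finite-dimensional real normed spaces and $A:E_1\to E_2^*$ linear, with $\|A\|=\max_{\|w\|=\|\alpha\|=1}\langle Aw,\alpha\rangle$ (dual spaces carry the dual norms). "$\sigma$-strongly convex on $Q$" means $h(ax+by)\le a\,h(x)+b\,h(y)-\tfrac{\sigma}{2}ab\|x-y\|^2$ for $x,y\in Q$, $a,b\ge 0$, $a+b=1$. Let $Q_1\subseteq E_1$ be closed and convex. Let $d_1$ be lower semicontinuous and $\sigma_1$-strongly convex on $Q_1$ ($\sigma_1>0$) and differentiable on the relative interior of $Q_1$, and put $\Delta(x,y)=d_1(x)-d_1(y)-\langle\nabla d_1(y),x-y\rangle$. Let $\Omega:Q_1\to\mathbb R$ (extended by $+\infty$ outside $Q_1$) be lower semicontinuous, convex and $\lambda$-strongly convex with respect to $d_1$, $\lambda\ge 0$: $\Omega(x)\ge\Omega(y)+\langle s,x-y\rangle+\lambda\Delta(x,y)$ for all $x,y\in Q_1$ with $d_1$ differentiable at $y$ and all $s\in\partial\Omega(y)$. Let $Q_2\subseteq E_2$ be closed and convex, $g:Q_2\to\mathbb R$ convex, and let $d_2$ be $\sigma_2$-strongly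 convex on $Q_2$ ($\sigma_2>0$) with $\min_{Q_2}d_2=0$ and $D:=\max_{Q_2}d_2\in(0,\infty)$. Put $$g^\star(u)=\sup_{\alpha\in Q_2}\{\langle u,\alpha\rangle-g(\alpha)\},\qquad g^\star_\mu(u)=\sup_{\alpha\in Q_2}\{\langle u,\alpha\rangle-g(\alpha)-\mu d_2(\alpha)\},$$ $$J(w)=\Omega(w)+g^\star(Aw),\qquad J_\mu(w)=\Omega(w)+g^\star_\mu(Aw),$$ and let $w^*\in Q_1$ minimize $J$ over $Q_1$. Let $\varepsilon>0$, $\mu=\varepsilon/D$ and $f(w)=g^\star_\mu(Aw)$. AGM-EF-$\infty$, applied to $J_\mu=f+\Omega$ with constant $L>0$ from a point $u_0\in Q_1$ at which $d_1$ is differentiable, is the following iteration. Set $w_0=z_0=u_0$, $A_0=0$, $\psi_0=\Delta(\cdot,u_0)$. For $k=0,1,\dots$: let $a_{k+1}$ be the positive root $a$ of $(a+A_k)(\lambda A_k+1)+\lambda aA_k=\frac{L}{\sigma_1}a^2$; put $A_{k+1}=A_k+a_{k+1}$, $\tau_1=1+\lambda A_k$, $\tau_3=\lambda a_{k+1}A_k/A_{k+1}$,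 $\tau=\tau_1+\tau_3$, $u_{k+1}=\frac{a_{k+1}\tau_1z_k+(\tau A_k+\tau_3a_{k+1})w_k}{\tau A_{k+1}}$, $\psi_{k+1}(x)=\psi_k(x)+a_{k+1}[\Omega(x)+f(u_{k+1})+\langle\nabla f(u_{k+1}),x-u_{k+1}\rangle]$, $z_{k+1}\in\operatorname{argmin}_{Q_1}\psi_{k+1}$, $w_{k+1}=(A_kw_k+a_{k+1}z_{k+1})/A_{k+1}$. **Theorem.** The function $f$ is differentiable on $E_1$ and its gradient is Lipschitz with constant $L_\mu:=\frac{\|A\|^2D}{\sigma_2\varepsilon}$. For every $L>0$ and every such $u_0$ the method has a run. If $0<L\le L_\mu$ is a Lipschitz constant of $\nabla f$ on $Q_1$ (for example $L=L_\mu$ when $A\ne 0$), then for every run and every integer $k\ge1$ with $$k\ \ge\ \min\left\{\frac1\varepsilon\sqrt{\frac{4D\|A\|^2}{\sigma_1\sigma_2}\Delta(w^*,u_0)},\ \ 1+\frac{\frac12\ln\left(\frac{4D\|A\|^2}{\sigma_1\sigma_2\varepsilon^2}\Delta(w^*,u_0)\right)}{\ln\left(1+\sqrt{\frac{\sigma_1\sigma_2\lambda\varepsilon}{4D\|A\|^2}}\right)}\right\}$$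 (the second term is omitted if $\lambda=0$), $w_k$ is a $2\varepsilon$-accurate solution of $J$: $w_k\in Q_1$ and $J(w_k)\le J(w)+2\varepsilon$ for all $w\in Q_1$. -/

import Mathlib

noncomputable section

namespace AccGrad

variable {E : Type*} [NormedAddCommGroup E] [NormedSpace ℝ E]

/-- The Bregman divergence `Δ_d(x, y) = d(x) - d(y) - ⟨∇d(y), x - y⟩`. -/
def bregman (d : E → ℝ) (x y : E) : ℝ :=
  d x - d y - fderiv ℝ d y (x - y)

/-- The subdifferential at `y` of the extended-valued function that equals `f` on `Q` and `+∞`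
outside `Q`. -/
def subdiffOn (Q : Set E) (f : E → ℝ) (y : E) : Set (StrongDual ℝ E) :=
  {s | ∀ x ∈ Q, f y + s (x - y) ≤ f x}

/-- A prox-function on `Q` with modulus `σ` for the norm of the space: strongly convex on `Q`,
i.e. `d (a x + b y) ≤ a d x + b d y - a b (σ / 2) ‖x - y‖²`, lower semicontinuous on `Q`, and
differentiable on the relative interior of `Q`. Every function that is `σ`-strongly convex on `Q`
and differentiable at all points of `Q` is one, and so is the entropy on the simplex, which is not
differentiable at the relative boundary. -/
structure IsProxOn (Q : Set E) (σ : ℝ) (d : E → ℝ) : Prop where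
  modulus_pos : 0 < σ
  strongConvex : StrongConvexOn Q σ d
  lsc : LowerSemicontinuousOn d Q
  differentiable : ∀ y ∈ intrinsicInterior ℝ Q, DifferentiableAt ℝ d y

/-- `f` (with `+∞` outside `Q`) is `lam`-strongly convex with respect to `d`:
it is convex and `f x ≥ f y + ⟨s, x - y⟩ + lam Δ_d(x, y)` for every subgradient `s` at `y`,
at all points `y` where `∇d(y)` exists. -/
def IsScWrt (Q : Set E) (lam : ℝ) (d f : E → ℝ) : Prop :=
  ConvexOn ℝ Q f ∧
    ∀ x ∈ Q, ∀ y ∈ Q, DifferentiableAt ℝ d y → ∀ s ∈ subdiffOn Q f y,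
      f y + s (x - y) + lam * bregman d x y ≤ f x

/-- `f` is differentiable on `Q` with gradient `L`-Lipschitz on `Q`, from the norm of the space to
the dual norm. -/
def IsLcgOn (Q : Set E) (L : ℝ) (f : E → ℝ) : Prop :=
  (∀ x ∈ Q, DifferentiableAt ℝ f x) ∧
    ∀ x ∈ Q, ∀ y ∈ Q, ‖fderiv ℝ f x - fderiv ℝ f y‖ ≤ L * ‖x - y‖

/-- The Fenchel dual of the function that equals `g` on `Q` and `+∞` outside `Q`,
`g⋆(u) = sup_{α ∈ Q} (⟨u, α⟩ - g(α))`. Used only for `g` convex on a nonempty bounded convex set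
`Q` of a finite-dimensional space, where the supremum is finite. -/
def fenchelOn (Q : Set E) (g : E → ℝ) (u : StrongDual ℝ E) : ℝ :=
  sSup ((fun α => u α - g α) '' Q)

/-- The smoothed dual `g⋆_μ = (g + μ d₂)⋆`. -/
def smoothedFenchelOn (Q : Set E) (g d₂ : E → ℝ) (μ : ℝ) (u : StrongDual ℝ E) : ℝ :=
  fenchelOn Q (fun α => g α + μ * d₂ α) u

/-- `w` is a `δ`-accurate solution of `min_{y ∈ Q} J y`. -/
def IsAccurateSolution (Q : Set E) (J : E → ℝ) (δ : ℝ) (w : E) : Prop :=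
  w ∈ Q ∧ ∀ y ∈ Q, J w ≤ J y + δ

/-- The lower model `ℓ_f(x; y, lam₁) = f(y) + ⟨∇f(y), x - y⟩ + lam₁ Δ_d(x, y)`. -/
def lowerModel (d f : E → ℝ) (lam₁ : ℝ) (x y : E) : ℝ :=
  f y + fderiv ℝ f y (x - y) + lam₁ * bregman d x y

/-- The estimate functions
`ψ₀ = Δ_d(·, x₀)`, `ψ_{k+1} = ψ_k + a_{k+1} (Ψ + ℓ_f(·; u_{k+1}, lam₁))`. -/
def estimate (d f Ψ : E → ℝ) (lam₁ : ℝ) (x₀ : E) (u : ℕ → E) (a : ℕ → ℝ) : ℕ → E → ℝ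
  | 0, x => bregman d x x₀
  | k + 1, x => estimate d f Ψ lam₁ x₀ u a k x
      + a (k + 1) * (Ψ x + lowerModel d f lam₁ x (u (k + 1)))

/-- The sequences `x, z, u, a, S` are produced by the `∞`-memory accelerated gradient method with
estimate functions (AGM-EF-∞) applied to `f + Ψ`, where `Ψ` has domain `Q`, the prox-function is
`d` with modulus `σ`, `L` is the Lipschitz constant handed to the method, and `f`, `Ψ` are treated
as `lam₁`-, `lam₂`-strongly convex wrt `d`. Here `S k = a 1 + ⋯ + a k`; the entries `a 0` and `u 0`
are not used. -/
structure IsAGMRun (Q : Set E) (d f Ψ : E → ℝ) (σ L lam₁ lam₂ : ℝ)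
    (x z u : ℕ → E) (a S : ℕ → ℝ) : Prop where
  x_zero_mem : x 0 ∈ Q
  z_zero : z 0 = x 0
  S_zero : S 0 = 0
  a_pos : ∀ k, 0 < a (k + 1)
  a_root : ∀ k,
    (a (k + 1) + S k) * (lam₁ * a (k + 1) + (lam₁ + lam₂) * S k + 1) + a (k + 1) * lam₂ * S k
      = L * σ⁻¹ * a (k + 1) ^ 2
  S_succ : ∀ k, S (k + 1) = S k + a (k + 1)
  u_succ : ∀ k, ∀ τ₁ τ₂ τ₃ τ : ℝ,
    τ₁ = 1 + (lam₁ + lam₂) * S k →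
    τ₂ = lam₁ * a (k + 1) →
    τ₃ = lam₂ * a (k + 1) * (S k / S (k + 1)) →
    τ = τ₁ + τ₂ + τ₃ →
    u (k + 1) = (τ * S (k + 1) - τ₂ * a (k + 1))⁻¹ •
      ((a (k + 1) * τ₁) • z k + (τ * S k + τ₃ * a (k + 1)) • x k)
  z_mem : ∀ k, z (k + 1) ∈ Q
  z_min : ∀ k, IsMinOn (estimate d f Ψ lam₁ (x 0) u a (k + 1)) Q (z (k + 1))
  x_succ : ∀ k, x (k + 1) = (S (k + 1))⁻¹ • (S k • x k + a (k + 1) • z (k + 1))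

/-- The iteration bound, with `normA = ‖A‖` and `Δ` the Bregman divergence from the starting point
to the minimizer. For `lam = 0` the second term of the minimum is `+∞`. -/
def iterationBound (ε D normA σ₁ σ₂ lam Δ : ℝ) : ℝ :=
  if 0 < lam then
    min (1 / ε * √(4 * D * normA ^ 2 / (σ₁ * σ₂) * Δ))
      (1 + 1 / 2 * Real.log (4 * D * normA ^ 2 / (σ₁ * σ₂ * ε ^ 2) * Δ)
        / Real.log (1 + √(σ₁ * σ₂ * lam * ε / (4 * D * normA ^ 2))))
  else 1 / ε * √(4 * D * normA ^ 2 / (σ₁ * σ₂) * Δ)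

end AccGrad

end

namespace AccGrad

open Filter Topology

/-! ### Convex analysis: relative interiors, subgradients, strong convexity, the descent inequality
-/

section ConvexAnalysis

variable {E : Type*} [NormedAddCommGroup E] [NormedSpace ℝ E]

/-! Smoothing costs at most `ε`: since `0 ≤ d₂ ≤ D` and `μ * D = ε`, the smoothed objective `J_μ = f
+ Ω` satisfies `J_μ ≤ J ≤ J_μ + ε`. It therefore suffices to bring `J_μ (w k)` within `ε` of `J_μ
wstar`. Strong convexity of `g + μ d₂` makes its conjugate smooth (`exists_gradient_fenchelOn`), and
composing with `A` gives the constant `‖A‖² / (μ σ₂)` (`isLcgOn_comp`). Neither `g` nor `d₂` is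
assumed semicontinuous, so the supremum need not be attained; limits of maximizing sequences replace
maximizers.

The method is analysed with estimate functions. Gradient inequalities for the convex `f` give `ψ_k ≤
Δ(·, u₀) + S_k J_μ` (`estimate_le`), and an induction gives `S_k J_μ(w_k) ≤ min ψ_k`
(`IsAGMRun.mul_le_estimate`). Evaluating at `wstar` yields `J_μ(w_k) - J_μ(wstar) ≤ Δ(wstar, u₀) /
S_k`. The root equation for the step sizes forces `S_k` to grow at least quadratically, and
geometrically if `lam > 0` (`div_le_of_recursion`); the iteration bound ensures `S_k ≥ Δ / ε`.

The hypothesis on `Ω` speaks only of points where `d₁` is differentiable. `IsScWrt.convexOn_sub`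
turns it into convexity of `Ω - lam d₁` on all of `Q₁`, which makes `ψ_k` strongly convex with
modulus `(1 + lam S_k) σ₁`. This gives both the existence of `z_k` and the quadratic growth used in
the induction. -/

theorem le_of_forall_convex_comb_le {a b c : ℝ}
    (h : ∀ t : ℝ, 0 < t → t < 1 → (1 - t) * a + t * b ≤ c) : a ≤ c := by
  have ht : Tendsto (fun t : ℝ => (1 - t) * a + t * b) (𝓝[>] 0) (𝓝 a) := by
    have : Continuous fun t : ℝ => (1 - t) * a + t * b := by fun_prop
    have := (this.tendsto 0).mono_left (nhdsWithin_le_nhds (s := Set.Ioi 0))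
    simpa using this
  refine le_of_tendsto ht ?_
  filter_upwards [Ioo_mem_nhdsGT (zero_lt_one' ℝ)] with t ht using h t ht.1 ht.2

theorem mem_intrinsicInterior_iff_exists_isOpen {Q : Set E} {y : E} :
    y ∈ intrinsicInterior ℝ Q ↔
      y ∈ affineSpan ℝ Q ∧ ∃ U : Set E, IsOpen U ∧ y ∈ U ∧ ∀ z ∈ U, z ∈ affineSpan ℝ Q → z ∈ Q := by
  rw [mem_intrinsicInterior]
  constructor
  · rintro ⟨y', hy', rfl⟩
    obtain ⟨V, hVs, hVo, hyV⟩ := mem_interior.1 hy'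
    obtain ⟨U, hU, rfl⟩ := isOpen_induced_iff.1 hVo
    exact ⟨y'.2, U, hU, hyV, fun z hz hza => hVs (a := ⟨z, hza⟩) hz⟩
  · rintro ⟨hya, U, hU, hyU, h⟩
    refine ⟨⟨y, hya⟩, mem_interior.2 ⟨((↑) : affineSpan ℝ Q → E) ⁻¹' U, fun z hz => h z hz z.2,
      hU.preimage continuous_subtype_val, hyU⟩, rfl⟩

/-- The homothety with centre `x` and ratio `t` carries a relative neighbourhood of `c` inside `Q`
to one of the new point, still inside `Q` by convexity. -/
theorem combo_mem_intrinsicInterior {Q : Set E} (hQ : Convex ℝ Q) {c x : E}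
    (hc : c ∈ intrinsicInterior ℝ Q) (hx : x ∈ Q) {t : ℝ} (ht : 0 < t) (ht1 : t ≤ 1) :
    (1 - t) • x + t • c ∈ intrinsicInterior ℝ Q := by
  rw [mem_intrinsicInterior_iff_exists_isOpen] at hc ⊢
  obtain ⟨hca, U, hU, hcU, h⟩ := hc
  have hxa := subset_affineSpan ℝ Q hx
  refine ⟨?_, (fun z => x + t⁻¹ • (z - x)) ⁻¹' U, hU.preimage (by fun_prop), ?_, ?_⟩
  · have := AffineMap.lineMap_mem (Q := affineSpan ℝ Q) t hxa hca
    rwa [AffineMap.lineMap_apply_module] at this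
  · have : x + t⁻¹ • ((1 - t) • x + t • c - x) = c := by
      have : (1 - t) • x + t • c - x = t • (c - x) := by module
      rw [this, inv_smul_smul₀ ht.ne']; abel
    simpa [this] using hcU
  · intro z hz hza
    have h1 : x + t⁻¹ • (z - x) ∈ affineSpan ℝ Q := by
      have := AffineMap.lineMap_mem (Q := affineSpan ℝ Q) t⁻¹ hxa hza
      rwa [AffineMap.lineMap_apply_module', add_comm] at this
    have h2 := hQ hx (h _ hz h1) (sub_nonneg.2 ht1) ht.le (by ring)
    have h3 : (1 - t) • x + t • (x + t⁻¹ • (z - x)) = z := by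
      rw [smul_add, smul_inv_smul₀ ht.ne']; module
    rwa [h3] at h2

theorem exists_pos_add_smul_mem {Q : Set E} {y v : E} (hy : y ∈ intrinsicInterior ℝ Q)
    (hv : v ∈ (affineSpan ℝ Q).direction) : ∃ t : ℝ, 0 < t ∧ y + t • v ∈ Q := by
  obtain ⟨hya, U, hU, hyU, h⟩ := mem_intrinsicInterior_iff_exists_isOpen.1 hy
  have hcont : Continuous fun t : ℝ => y + t • v := by fun_prop
  have hmem : (fun t : ℝ => y + t • v) ⁻¹' U ∈ 𝓝[>] (0 : ℝ) :=
    mem_nhdsWithin_of_mem_nhds ((hU.preimage hcont).mem_nhds (by simpa using hyU))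
  obtain ⟨t, htU, ht⟩ := Filter.nonempty_of_mem (Filter.inter_mem hmem self_mem_nhdsWithin)
  refine ⟨t, ht, h _ htU ?_⟩
  have := AffineSubspace.vadd_mem_of_mem_direction
    ((affineSpan ℝ Q).direction.smul_mem t hv) hya
  rwa [vadd_eq_add, add_comm] at this

/-- The cone of feasible directions of the epigraph of `f` at the point `(y, f y)`. -/
def epigraphCone {Q : Set E} {f : E → ℝ} (hf : ConvexOn ℝ Q f) {y : E} (hy : y ∈ Q)
    (V : Submodule ℝ E) : PointedCone ℝ (V × ℝ) where
  carrier := {p | ∃ t : ℝ, 0 < t ∧ y + t • (p.1 : E) ∈ Q ∧ f (y + t • (p.1 : E)) - f y ≤ t * p.2}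
  zero_mem' := ⟨1, one_pos, by simpa using hy, by simp⟩
  add_mem' := by
    rintro ⟨v₁, c₁⟩ ⟨v₂, c₂⟩ ⟨t₁, ht₁, hQ₁, h₁⟩ ⟨t₂, ht₂, hQ₂, h₂⟩
    have hs : 0 < t₁ + t₂ := add_pos ht₁ ht₂
    have hab : t₂ / (t₁ + t₂) + t₁ / (t₁ + t₂) = 1 := by field_simp; ring
    have ha : 0 ≤ t₂ / (t₁ + t₂) := by positivity
    have hb : 0 ≤ t₁ / (t₁ + t₂) := by positivity
    -- This step length puts the new point on the segment joining the two given points of `Q`.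
    have key : y + (t₁ * t₂ / (t₁ + t₂)) • ((v₁ : E) + v₂) =
        (t₂ / (t₁ + t₂)) • (y + t₁ • (v₁ : E)) + (t₁ / (t₁ + t₂)) • (y + t₂ • (v₂ : E)) := by
      have e : ∀ a b : ℝ, a + b = 1 → a • (y + t₁ • (v₁ : E)) + b • (y + t₂ • (v₂ : E)) =
          y + ((a * t₁) • (v₁ : E) + (b * t₂) • (v₂ : E)) := by
        intro a b hab
        obtain rfl : b = 1 - a := by linarith
        module
      rw [e _ _ hab, smul_add]
      congr 3 <;> ring
    refine ⟨t₁ * t₂ / (t₁ + t₂), by positivity, ?_, ?_⟩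
    · simp only [Prod.mk_add_mk, Submodule.coe_add, key]
      exact hf.1 hQ₁ hQ₂ ha hb hab
    · simp only [Prod.mk_add_mk, Submodule.coe_add, key]
      have h3 := hf.2 hQ₁ hQ₂ ha hb hab
      have h4 := mul_le_mul_of_nonneg_left h₁ ha
      have h5 := mul_le_mul_of_nonneg_left h₂ hb
      simp only [smul_eq_mul] at h3
      have e : t₁ * t₂ / (t₁ + t₂) * (c₁ + c₂) =
          t₂ / (t₁ + t₂) * (t₁ * c₁) + t₁ / (t₁ + t₂) * (t₂ * c₂) := by ring
      rw [e]
      linear_combination h3 + h4 + h5 + (f y) * hab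
  smul_mem' := by
    rintro ⟨r, hr⟩ ⟨v, c⟩ ⟨t, ht, hQ, h⟩
    rcases hr.eq_or_lt with rfl | hr
    · exact ⟨1, one_pos, by simpa using hy, by simp⟩
    · refine ⟨t / r, by positivity, ?_⟩
      have e : (t / r) • (r • (v : E)) = t • (v : E) := by
        rw [smul_smul, div_mul_cancel₀ _ hr.ne']
      have e2 : t / r * (r * c) = t * c := by field_simp
      simpa [Nonneg.mk_smul, e, e2] using And.intro hQ h

/-- Riesz extension of the functional `(0, c) ↦ c` from the vertical line to one that is nonnegative
on the epigraph cone; its horizontal part, negated, is the subgradient. Relative interiority makes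
every direction of the affine span feasible, so a vertical shift brings any vector into the cone, as
the extension theorem requires. -/
theorem exists_mem_subdiffOn [FiniteDimensional ℝ E] {Q : Set E} {f : E → ℝ}
    (hf : ConvexOn ℝ Q f) {y : E} (hy : y ∈ intrinsicInterior ℝ Q) :
    ∃ s, s ∈ subdiffOn Q f y := by
  have hyQ := intrinsicInterior_subset hy
  set V := (affineSpan ℝ Q).direction with hV
  let p : (V × ℝ) →ₗ.[ℝ] ℝ :=
    { domain := LinearMap.ker (LinearMap.fst ℝ V ℝ)
      toFun := (LinearMap.snd ℝ V ℝ).comp (Submodule.subtype _) }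
  obtain ⟨F, hF, hpos⟩ := riesz_extension (epigraphCone hf hyQ V) p
    (by
      rintro ⟨⟨v, c⟩, hv⟩ ⟨t, ht, hQ, h⟩
      have hv0 : v = 0 := hv
      subst hv0
      have h' : 0 ≤ t * c := by simpa using h
      exact nonneg_of_mul_nonneg_right h' ht)
    (by
      rintro ⟨v, c⟩
      obtain ⟨t, ht, hQ⟩ := exists_pos_add_smul_mem hy v.2
      refine ⟨⟨(0, t⁻¹ * (f (y + t • (v : E)) - f y) - c), by simp [p]⟩, t, ht, ?_, ?_⟩
      · simpa using hQ
      · simp only [Prod.mk_add_mk, zero_add, sub_add_cancel]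
        rw [mul_inv_cancel_left₀ ht.ne'])
  obtain ⟨G, hG⟩ := LinearMap.exists_extend (F.comp (LinearMap.inl ℝ V ℝ))
  refine ⟨-(LinearMap.toContinuousLinearMap G), fun x hx => ?_⟩
  have hxV : x - y ∈ V := by
    simpa using AffineSubspace.vsub_mem_direction (subset_affineSpan ℝ Q hx)
      (subset_affineSpan ℝ Q hyQ)
  have h1 := hpos (⟨x - y, hxV⟩, f x - f y) ⟨1, one_pos, by simpa using hx, by simp⟩
  have h2 : F ((0 : V), f x - f y) = f x - f y := by
    have := hF ⟨((0 : V), f x - f y), by simp [p]⟩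
    simpa [p] using this
  have h3 : G (x - y) = F (⟨x - y, hxV⟩, 0) := by
    have := LinearMap.congr_fun hG ⟨x - y, hxV⟩
    simpa using this
  have h4 : F (⟨x - y, hxV⟩, f x - f y) = F (⟨x - y, hxV⟩, 0) + F ((0 : V), f x - f y) := by
    rw [← map_add]; simp
  have h5 : (-(LinearMap.toContinuousLinearMap G)) (x - y) = - G (x - y) := by simp
  rw [h5]
  linarith

/-- `lam`-strong convexity with respect to `d`, required only at subgradients where `d` is
differentiable, makes `f - lam d` convex on the whole of `Q`. -/
theorem IsScWrt.convexOn_sub [FiniteDimensional ℝ E] {Q : Set E} {σ lam : ℝ} {d f : E → ℝ}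
    (hd : IsProxOn Q σ d) (hf : IsScWrt Q lam d f) (hlsc : LowerSemicontinuousOn f Q)
    (hlam : 0 ≤ lam) : ConvexOn ℝ Q (fun x => f x - lam * d x) := by
  refine ⟨hf.1.1, fun x hx x' hx' a b ha hb hab => ?_⟩
  obtain ⟨c, hc⟩ := Set.Nonempty.intrinsicInterior hf.1.1 ⟨x, hx⟩
  have hcQ := intrinsicInterior_subset hc
  have hdc : ConvexOn ℝ Q d := hd.strongConvex.convexOn fun r => by
    have := hd.modulus_pos
    simp only [Pi.zero_apply]; positivity
  set y := a • x + b • x' with hy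
  have hyQ : y ∈ Q := hf.1.1 hx hx' ha hb hab
  simp only [smul_eq_mul]
  set H := a * (f x - lam * d x) + b * (f x' - lam * d x') with hH
  -- Moving `y` slightly towards `c` reaches the relative interior, where a subgradient and `∇d`
  -- both exist. The inequalities towards `x`, `x'`, `c` are averaged with barycentric weights, so
  -- all linear terms cancel. Convexity of `d` bounds `d z`, and semicontinuity is needed for `f`
  -- alone as `t → 0`.
  have key : ∀ t : ℝ, 0 < t → t < 1 →
      f ((1 - t) • y + t • c) ≤ (1 - t) * (H + lam * d y) + t * f c := by
    intro t ht ht1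
    have hz := combo_mem_intrinsicInterior hf.1.1 hc hyQ ht ht1.le
    set z := (1 - t) • y + t • c with hzdef
    have hzQ := intrinsicInterior_subset hz
    obtain ⟨s, hs⟩ := exists_mem_subdiffOn hf.1 hz
    have hdz := hd.differentiable z hz
    have e1 := hf.2 x hx z hzQ hdz s hs
    have e2 := hf.2 x' hx' z hzQ hdz s hs
    have e3 := hf.2 c hcQ z hzQ hdz s hs
    have e4 := hdc.2 hyQ hcQ (sub_nonneg.2 ht1.le) ht.le (by ring)
    rw [← hzdef] at e4
    simp only [smul_eq_mul] at e4
    have lin : ∀ ℓ : StrongDual ℝ E,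
        (1 - t) * (a * ℓ (x - z) + b * ℓ (x' - z)) + t * ℓ (c - z) = 0 := by
      intro ℓ
      have : (1 - t) • (a • (x - z) + b • (x' - z)) + t • (c - z) = 0 := by
        have : a • (x - z) + b • (x' - z) = y - z := by
          obtain rfl : b = 1 - a := by linarith
          rw [hy]; module
        rw [this]
        have : (1 - t) • (y - z) + t • (c - z) = ((1 - t) • y + t • c) - z := by module
        rw [this, ← hzdef, sub_self]
      have := congrArg ℓ this
      simpa only [map_add, map_smul, smul_eq_mul, map_zero] using this
    have l1 := lin s
    have l2 := lin (fderiv ℝ d z)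
    have m1 := mul_le_mul_of_nonneg_left e1 ha
    have m2 := mul_le_mul_of_nonneg_left e2 hb
    have m12 := mul_le_mul_of_nonneg_left (add_le_add m1 m2) (sub_nonneg.2 ht1.le)
    have m3 := mul_le_mul_of_nonneg_left e3 ht.le
    have m4 := mul_le_mul_of_nonneg_left e4 hlam
    obtain rfl : b = 1 - a := by linarith
    unfold bregman at m12 m3
    rw [hH]
    linear_combination m12 + m3 + m4 - l1 + lam * l2
  have hlim : Tendsto (fun t : ℝ => (1 - t) • y + t • c) (𝓝[>] 0) (𝓝[Q] y) := by
    refine tendsto_nhdsWithin_iff.2 ⟨?_, ?_⟩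
    · have : Continuous fun t : ℝ => (1 - t) • y + t • c := by fun_prop
      have := (this.tendsto 0).mono_left (nhdsWithin_le_nhds (s := Set.Ioi 0))
      simpa using this
    · filter_upwards [Ioo_mem_nhdsGT (zero_lt_one' ℝ)] with t ht
      exact hf.1.1 hyQ hcQ (sub_nonneg.2 ht.2.le) ht.1.le (by ring)
  have hlim2 : Tendsto (fun t : ℝ => (1 - t) * (H + lam * d y) + t * f c) (𝓝[>] 0)
      (𝓝 (H + lam * d y)) := by
    have : Continuous fun t : ℝ => (1 - t) * (H + lam * d y) + t * f c := by fun_prop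
    have := (this.tendsto 0).mono_left (nhdsWithin_le_nhds (s := Set.Ioi 0))
    simpa using this
  suffices f y ≤ H + lam * d y by linarith
  refine le_of_forall_lt fun r hr => ?_
  obtain ⟨r', hr', hr'f⟩ := exists_between hr
  refine hr'.trans_le (ge_of_tendsto hlim2 ?_)
  filter_upwards [hlim.eventually (hlsc y hyQ r' hr'f), Ioo_mem_nhdsGT (zero_lt_one' ℝ)]
    with t h1 h2
  exact h1.le.trans (key t h2.1 h2.2)

theorem strongConvexOn_comb {Q : Set E} {σ p q : ℝ} {d h F : E → ℝ} (hd : StrongConvexOn Q σ d)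
    (hh : ConvexOn ℝ Q h) (hp : 0 ≤ p) (hq : 0 ≤ q) (l : StrongDual ℝ E) (c : ℝ)
    (hF : ∀ x, F x = p * d x + q * h x + l x + c) : StrongConvexOn Q (p * σ) F := by
  refine ⟨hd.1, fun x hx y hy a b ha hb hab => ?_⟩
  have h1 := mul_le_mul_of_nonneg_left (hd.2 hx hy ha hb hab) hp
  have h2 := mul_le_mul_of_nonneg_left (hh.2 hx hy ha hb hab) hq
  simp only [hF, map_add, map_smul, smul_eq_mul] at h1 h2 ⊢
  obtain rfl : b = 1 - a := by linarith
  linear_combination h1 + h2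

theorem StrongConvexOn.add_sq_le_of_isMinOn {Q : Set E} {m : ℝ} {F : E → ℝ}
    (hF : StrongConvexOn Q m F) {z : E} (hz : z ∈ Q) (hmin : IsMinOn F Q z) {x : E} (hx : x ∈ Q) :
    F z + m / 2 * ‖x - z‖ ^ 2 ≤ F x := by
  refine le_of_forall_convex_comb_le (b := F z) fun t ht ht1 => ?_
  have h1 := hF.2 hx hz ht.le (sub_nonneg.2 ht1.le) (by ring)
  have h2 : F z ≤ F (t • x + (1 - t) • z) :=
    hmin (hF.1 hx hz ht.le (sub_nonneg.2 ht1.le) (by ring))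
  simp only [smul_eq_mul] at h1
  have h3 : t * ((1 - t) * (m / 2 * ‖x - z‖ ^ 2)) ≤ t * (F x - F z) := by
    linear_combination h1 + h2
  linarith [le_of_mul_le_mul_left h3 ht]

/-- Strong convexity along rays from `x₀`, with a lower bound on the unit ball, forces quadratic
growth; minimizing over a large ball is then enough. -/
theorem StrongConvexOn.exists_isMinOn [FiniteDimensional ℝ E] {Q : Set E} {m : ℝ} {F : E → ℝ}
    (hF : StrongConvexOn Q m F) (hm : 0 < m) (hlsc : LowerSemicontinuousOn F Q)
    (hQ : IsClosed Q) (hne : Q.Nonempty) : ∃ z ∈ Q, IsMinOn F Q z := by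
  obtain ⟨x₀, hx₀⟩ := hne
  have hcomp : ∀ R, IsCompact (Q ∩ Metric.closedBall x₀ R) := fun R =>
    (isCompact_closedBall x₀ R).inter_left hQ
  have hmem : ∀ R, 0 ≤ R → x₀ ∈ Q ∩ Metric.closedBall x₀ R := fun R hR => ⟨hx₀, by simpa using hR⟩
  obtain ⟨y, hy, hymin⟩ := LowerSemicontinuousOn.exists_isMinOn ⟨x₀, hmem 1 zero_le_one⟩ (hcomp 1)
    (hlsc.mono Set.inter_subset_left)
  have hgrow : ∀ x ∈ Q, 1 ≤ ‖x - x₀‖ →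
      ‖x - x₀‖ * (F y - F x₀ + m / 2 * (‖x - x₀‖ - 1)) ≤ F x - F x₀ := by
    intro x hx hr
    set r := ‖x - x₀‖ with hrdef
    have hr0 : 0 < r := by linarith
    have hi : r⁻¹ ≤ 1 := inv_le_one_of_one_le₀ hr
    have h1 := hF.2 hx hx₀ (inv_nonneg.2 hr0.le) (sub_nonneg.2 hi) (by ring)
    have hQ' := hF.1 hx hx₀ (inv_nonneg.2 hr0.le) (sub_nonneg.2 hi) (by ring)
    have hb : r⁻¹ • x + (1 - r⁻¹) • x₀ ∈ Metric.closedBall x₀ 1 := by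
      rw [mem_closedBall_iff_norm]
      have : r⁻¹ • x + (1 - r⁻¹) • x₀ - x₀ = r⁻¹ • (x - x₀) := by module
      rw [this, norm_smul, ← hrdef, norm_inv, Real.norm_of_nonneg hr0.le, inv_mul_cancel₀ hr0.ne']
    have h2 : F y ≤ _ := hymin ⟨hQ', hb⟩
    simp only [smul_eq_mul, ← hrdef] at h1
    have h3 := mul_le_mul_of_nonneg_left (h2.trans h1) hr0.le
    have e : r * (r⁻¹ * F x + (1 - r⁻¹) * F x₀ - r⁻¹ * (1 - r⁻¹) * (m / 2 * r ^ 2)) =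
        F x + (r - 1) * F x₀ - (r - 1) * (m / 2 * r) := by field_simp
    rw [e] at h3
    linarith
  -- Chosen so that the growth factor in `hgrow` is at least `m / 2` beyond radius `R`.
  set R := 1 + 2 / m * (F x₀ - F y) + 1 with hR
  have hyx : F y ≤ F x₀ := hymin (hmem 1 zero_le_one)
  have hR1 : 1 ≤ R := by
    have : 0 ≤ 2 / m * (F x₀ - F y) := mul_nonneg (by positivity) (by linarith)
    linarith
  obtain ⟨z, hz, hzmin⟩ := LowerSemicontinuousOn.exists_isMinOn
    ⟨x₀, hmem R (by linarith)⟩ (hcomp R) (hlsc.mono Set.inter_subset_left)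
  refine ⟨z, hz.1, fun x hx => ?_⟩
  by_cases hxR : ‖x - x₀‖ ≤ R
  · exact hzmin ⟨hx, mem_closedBall_iff_norm.2 hxR⟩
  · push Not at hxR
    have h1 := hgrow x hx (by linarith)
    have h2 : 0 ≤ F y - F x₀ + m / 2 * (‖x - x₀‖ - 1) := by
      have h3 : m / 2 * (R - 1) ≤ m / 2 * (‖x - x₀‖ - 1) := by gcongr
      have h4 : m / 2 * (R - 1) = F x₀ - F y + m / 2 := by rw [hR]; field_simp; ring
      linarith
    have h3 : 0 ≤ F x - F x₀ := le_trans (mul_nonneg (norm_nonneg _) h2) h1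
    have h4 : F z ≤ F x₀ := hzmin (hmem R (by linarith))
    show F z ≤ F x
    linarith

theorem ConvexOn.fderiv_sub_le {Q : Set E} {d : E → ℝ} (hd : ConvexOn ℝ Q d) {x y : E}
    (hx : x ∈ Q) (hy : y ∈ Q) (hdiff : DifferentiableAt ℝ d y) :
    fderiv ℝ d y (x - y) ≤ d x - d y := by
  have h := (hdiff.hasFDerivAt.hasLineDerivAt (x - y)).tendsto_slope_zero_right
  refine le_of_tendsto h ?_
  filter_upwards [Ioo_mem_nhdsGT (zero_lt_one' ℝ)] with t ht
  have h1 := hd.2 hx hy ht.1.le (sub_nonneg.2 ht.2.le) (by ring)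
  have e : t • x + (1 - t) • y = y + t • (x - y) := by module
  rw [e] at h1
  simp only [smul_eq_mul] at h1 ⊢
  rw [inv_mul_le_iff₀ ht.1]
  linarith

/-- Along the segment, the gap between `f` and its quadratic upper model has nonpositive derivative.
-/
theorem IsLcgOn.le_add_sq {Q : Set E} (hQ : Convex ℝ Q) {L : ℝ} {f : E → ℝ} (hf : IsLcgOn Q L f)
    {x y : E} (hx : x ∈ Q) (hy : y ∈ Q) :
    f y ≤ f x + fderiv ℝ f x (y - x) + L / 2 * ‖y - x‖ ^ 2 := by
  set φ : ℝ → ℝ := fun t => f (x + t • (y - x)) - t * fderiv ℝ f x (y - x)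
    - L / 2 * t ^ 2 * ‖y - x‖ ^ 2 with hφ
  have hmem : ∀ t ∈ Set.Icc (0 : ℝ) 1, x + t • (y - x) ∈ Q := fun t ht =>
    hQ.add_smul_sub_mem hx hy ht
  have hder : ∀ t ∈ Set.Icc (0 : ℝ) 1, HasDerivAt φ
      (fderiv ℝ f (x + t • (y - x)) (y - x) - fderiv ℝ f x (y - x) - L * t * ‖y - x‖ ^ 2) t := by
    intro t ht
    have h1 : HasDerivAt (fun t : ℝ => x + t • (y - x)) (y - x) t := by
      simpa using ((hasDerivAt_id t).smul_const (y - x)).const_add x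
    have h2 := (hf.1 _ (hmem t ht)).hasFDerivAt.comp_hasDerivAt t h1
    have h3 := (h2.sub ((hasDerivAt_id t).mul_const (fderiv ℝ f x (y - x)))).sub
      ((((hasDerivAt_id t).pow 2).const_mul (L / 2)).mul_const (‖y - x‖ ^ 2))
    refine h3.congr_deriv ?_
    simp only [id, Nat.cast_ofNat, Nat.add_one_sub_one, pow_one, mul_one, one_mul]
    ring
  have hanti : AntitoneOn φ (Set.Icc 0 1) := by
    refine antitoneOn_of_deriv_nonpos (convex_Icc 0 1)
      (fun t ht => (hder t ht).continuousAt.continuousWithinAt)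
      (fun t ht => (hder t (interior_subset ht)).differentiableAt.differentiableWithinAt)
      fun t ht => ?_
    have ht' := interior_subset ht
    rw [(hder t ht').deriv]
    have h1 := hf.2 _ (hmem t ht') x hx
    have h2 := (le_abs_self _).trans
      ((fderiv ℝ f (x + t • (y - x)) - fderiv ℝ f x).le_opNorm (y - x))
    have h3 := mul_le_mul_of_nonneg_right h1 (norm_nonneg (y - x))
    rw [add_sub_cancel_left, norm_smul, Real.norm_of_nonneg ht'.1] at h3
    rw [sub_apply] at h2
    linarith
  have h := hanti (Set.left_mem_Icc.2 zero_le_one) (Set.right_mem_Icc.2 zero_le_one) zero_le_one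
  simp only [hφ, one_smul, zero_smul, add_zero, add_sub_cancel] at h
  linarith

end ConvexAnalysis

/-! ### Smoothing by conjugation with a strongly convex function -/

section Smoothing

variable {E F : Type*} [NormedAddCommGroup E] [NormedSpace ℝ E]
  [NormedAddCommGroup F] [NormedSpace ℝ F]

theorem bddAbove_fenchelOn {Q : Set F} (hQ : IsCompact Q) {G : F → ℝ} {B : ℝ}
    (hB : ∀ α ∈ Q, B ≤ G α) (u : StrongDual ℝ F) : BddAbove ((fun α => u α - G α) '' Q) := by
  obtain ⟨M, hM⟩ := hQ.bddAbove_image u.continuous.continuousOn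
  refine ⟨M - B, ?_⟩
  rintro _ ⟨α, hα, rfl⟩
  exact sub_le_sub (hM ⟨α, hα, rfl⟩) (hB α hα)

/-- Compactness provides a convergent maximizing sequence. Strong convexity between `γ` and its
terms, passed to the limit and divided by `t → 0`, yields quadratic growth about the limit `α`, even
if the supremum is not attained there. -/
theorem exists_tendsto_fenchelOn {Q : Set F} (hQ : IsCompact Q) (hne : Q.Nonempty) {G : F → ℝ}
    {m B : ℝ} (hG : StrongConvexOn Q m G) (hB : ∀ α ∈ Q, B ≤ G α) (u : StrongDual ℝ F) :
    ∃ α, (∃ β : ℕ → F, (∀ n, β n ∈ Q) ∧ Tendsto β atTop (𝓝 α) ∧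
        Tendsto (fun n => u (β n) - G (β n)) atTop (𝓝 (fenchelOn Q G u))) ∧
      ∀ γ ∈ Q, u γ - G γ + m / 2 * ‖γ - α‖ ^ 2 ≤ fenchelOn Q G u := by
  have hbdd := bddAbove_fenchelOn hQ hB u
  obtain ⟨s, -, hs, hsmem⟩ := exists_seq_tendsto_sSup (hne.image (fun α => u α - G α)) hbdd
  choose β₀ hβ₀ hβ₀s using hsmem
  obtain ⟨α, hα, ι, hι, hlim⟩ := hQ.tendsto_subseq hβ₀
  have hval : Tendsto (fun n => u (β₀ (ι n)) - G (β₀ (ι n))) atTop (𝓝 (fenchelOn Q G u)) := by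
    have := hs.comp hι.tendsto_atTop
    refine this.congr fun n => ?_
    simp only [Function.comp_apply, ← hβ₀s]
  refine ⟨α, ⟨fun n => β₀ (ι n), fun n => hβ₀ _, hlim, hval⟩, fun γ hγ => ?_⟩
  have hnorm : Tendsto (fun n => ‖γ - β₀ (ι n)‖ ^ 2) atTop (𝓝 (‖γ - α‖ ^ 2)) :=
    ((tendsto_const_nhds.sub hlim).norm).pow 2
  have key : ∀ t : ℝ, 0 < t → t < 1 →
      (1 - t) * (m / 2 * ‖γ - α‖ ^ 2) + t * 0 ≤ fenchelOn Q G u - (u γ - G γ) := by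
    intro t ht ht1
    have h1 : (1 - t) * fenchelOn Q G u + t * (u γ - G γ)
        + t * (1 - t) * (m / 2 * ‖γ - α‖ ^ 2) ≤ fenchelOn Q G u := by
      refine le_of_tendsto' (x := (atTop : Filter ℕ)) (f := fun n => (1 - t) * (u (β₀ (ι n)) - G (β₀ (ι n)))
        + t * (u γ - G γ) + t * (1 - t) * (m / 2 * ‖γ - β₀ (ι n)‖ ^ 2)) ?_ fun n => ?_
      · exact ((hval.const_mul _).add_const _).add ((hnorm.const_mul _).const_mul _)
      · have h2 := hG.2 hγ (hβ₀ (ι n)) ht.le (sub_nonneg.2 ht1.le) (by ring)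
        have h3 := le_csSup hbdd ⟨_, hG.1 hγ (hβ₀ (ι n)) ht.le (sub_nonneg.2 ht1.le) (by ring), rfl⟩
        simp only [map_add, map_smul, smul_eq_mul] at h2 h3
        unfold fenchelOn
        linarith
    have h4 : t * ((1 - t) * (m / 2 * ‖γ - α‖ ^ 2)) ≤ t * (fenchelOn Q G u - (u γ - G γ)) := by
      linear_combination h1
    linarith [le_of_mul_le_mul_left h4 ht]
  linarith [le_of_forall_convex_comb_le key]

/-- The Fenchel dual of a strongly convex function has a Lipschitz gradient; lower semicontinuity
of the function is not needed. -/
theorem exists_gradient_fenchelOn {Q : Set F} (hQ : IsCompact Q) (hne : Q.Nonempty) {G : F → ℝ}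
    {m B : ℝ} (hm : 0 < m) (hG : StrongConvexOn Q m G) (hB : ∀ α ∈ Q, B ≤ G α) :
    ∃ α : StrongDual ℝ F → F,
      (∀ u v, fenchelOn Q G u + (v - u) (α u) ≤ fenchelOn Q G v) ∧
      (∀ u v, fenchelOn Q G v ≤ fenchelOn Q G u + (v - u) (α u) + ‖v - u‖ ^ 2 / (2 * m)) ∧
      ∀ u v, ‖α u - α v‖ ≤ ‖u - v‖ / m := by
  choose α hα hαmax using exists_tendsto_fenchelOn hQ hne hG hB
  -- Quadratic growth for `u` is tested on a maximizing sequence for `v`. Adding the same bound with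
  -- `u`, `v` exchanged makes `α` cocoercive-like: `m ‖α u - α v‖² ≤ (u - v) (α u - α v)`, hence
  -- Lipschitz.
  have hquad : ∀ u v, fenchelOn Q G v + (u - v) (α v) + m / 2 * ‖α v - α u‖ ^ 2 ≤
      fenchelOn Q G u := by
    intro u v
    obtain ⟨β, hβ, hlim, hval⟩ := hα v
    refine le_of_tendsto' (x := (atTop : Filter ℕ)) (f := fun n => (v (β n) - G (β n)) + (u - v) (β n)
      + m / 2 * ‖β n - α u‖ ^ 2) ?_ fun n => ?_
    · exact (hval.add (((u - v).continuous.tendsto _).comp hlim)).add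
        ((((hlim.sub_const _).norm).pow 2).const_mul _)
    · have := hαmax u (β n) (hβ n)
      rw [sub_apply]
      linarith
  refine ⟨α, fun u v => ?_, fun u v => ?_, fun u v => ?_⟩
  · have := hquad v u
    have : 0 ≤ m / 2 * ‖α u - α v‖ ^ 2 := by positivity
    linarith
  · refine csSup_le (hne.image _) ?_
    rintro _ ⟨γ, hγ, rfl⟩
    have h1 := hαmax u γ hγ
    have h2 := (le_abs_self _).trans ((v - u).le_opNorm (γ - α u))
    have h3 : ‖v - u‖ * ‖γ - α u‖ ≤ ‖v - u‖ ^ 2 / (2 * m) + m / 2 * ‖γ - α u‖ ^ 2 := by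
      have h4 : 0 ≤ (‖v - u‖ - m * ‖γ - α u‖) ^ 2 / (2 * m) := by positivity
      have h5 : (‖v - u‖ - m * ‖γ - α u‖) ^ 2 / (2 * m) =
          ‖v - u‖ ^ 2 / (2 * m) + m / 2 * ‖γ - α u‖ ^ 2 - ‖v - u‖ * ‖γ - α u‖ := by
        field_simp; ring
      linarith
    simp only [map_sub, sub_apply] at h2 ⊢
    linarith
  · rw [le_div_iff₀ hm]
    have h1 := hquad u v
    have h2 := hquad v u
    have h3 := (le_abs_self _).trans ((u - v).le_opNorm (α u - α v))
    rw [norm_sub_rev (α v) (α u)] at h1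
    simp only [map_sub, sub_apply] at h1 h2 h3
    by_contra! hlt
    have h4 : 0 < ‖α u - α v‖ := by
      by_contra! h0
      have : ‖α u - α v‖ = 0 := le_antisymm h0 (norm_nonneg _)
      rw [this, zero_mul] at hlt
      exact absurd hlt (not_lt.2 (norm_nonneg _))
    have h5 := mul_lt_mul_of_pos_right hlt h4
    linarith

/-- Composition of a smooth convex function on the dual of `F` with a linear map. -/
theorem isLcgOn_comp {φ : StrongDual ℝ F → ℝ} {α : StrongDual ℝ F → F} {m : ℝ} (hm : 0 < m)
    (hlow : ∀ u v, φ u + (v - u) (α u) ≤ φ v)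
    (hup : ∀ u v, φ v ≤ φ u + (v - u) (α u) + ‖v - u‖ ^ 2 / (2 * m))
    (hlip : ∀ u v, ‖α u - α v‖ ≤ ‖u - v‖ / m) (A : E →L[ℝ] StrongDual ℝ F) :
    IsLcgOn Set.univ (‖A‖ ^ 2 / m) (fun w => φ (A w)) ∧
      ∀ x y, φ (A x) + fderiv ℝ (fun w => φ (A w)) x (y - x) ≤ φ (A y) := by
  have hder : ∀ x, HasFDerivAt (fun w => φ (A w)) (A.flip (α (A x))) x := by
    intro x
    -- The two-sided bounds make the linearization error quadratic, so the derivative is `A.flip (α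
    -- (A x))`.
    have h0 : (fun y => φ (A y) - φ (A x) - A.flip (α (A x)) (y - x)) =O[𝓝 x]
        fun y => ‖y - x‖ ^ 2 := by
      refine Asymptotics.IsBigO.of_bound (‖A‖ ^ 2 / (2 * m)) (Eventually.of_forall fun y => ?_)
      have h1 := hlow (A x) (A y)
      have h2 := hup (A x) (A y)
      have h3 : ‖A y - A x‖ ^ 2 / (2 * m) ≤ ‖A‖ ^ 2 / (2 * m) * ‖y - x‖ ^ 2 := by
        rw [← map_sub, div_mul_eq_mul_div, ← mul_pow]
        gcongr
        exact A.le_opNorm _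
      rw [norm_pow, norm_norm, Real.norm_eq_abs, abs_le, ContinuousLinearMap.flip_apply, map_sub]
      constructor <;> [skip; linarith]
      have : 0 ≤ ‖A‖ ^ 2 / (2 * m) * ‖y - x‖ ^ 2 := by positivity
      linarith
    have h1 := h0.hasFDerivAt (𝕜 := ℝ) one_lt_two
    have h2 := (h1.add_const (φ (A x))).add
      ((A.flip (α (A x))).hasFDerivAt.sub_const (A.flip (α (A x)) x) (x := x))
    rw [zero_add] at h2
    refine h2.congr_of_eventuallyEq (Eventually.of_forall fun y => ?_)
    simp only [Pi.add_apply, map_sub]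
    ring
  refine ⟨⟨fun x _ => (hder x).differentiableAt, fun x _ y _ => ?_⟩, fun x y => ?_⟩
  · rw [(hder x).fderiv, (hder y).fderiv, ← map_sub]
    have h1 := A.flip.le_opNorm (α (A x) - α (A y))
    rw [ContinuousLinearMap.opNorm_flip] at h1
    have h2 := A.le_opNorm (x - y)
    rw [map_sub] at h2
    calc ‖A.flip (α (A x) - α (A y))‖ ≤ ‖A‖ * ‖α (A x) - α (A y)‖ := h1
      _ ≤ ‖A‖ * (‖A x - A y‖ / m) := by gcongr; exact hlip _ _
      _ ≤ ‖A‖ * (‖A‖ * ‖x - y‖ / m) := by gcongr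
      _ = ‖A‖ ^ 2 / m * ‖x - y‖ := by ring
  · rw [(hder x).fderiv, ContinuousLinearMap.flip_apply, map_sub]
    exact hlow _ _

/-- A subgradient at a relative interior point gives an affine minorant, which is bounded below on a
bounded set; no semicontinuity is needed. -/
theorem ConvexOn.exists_forall_le_of_isBounded [FiniteDimensional ℝ F] {Q : Set F} {g : F → ℝ}
    (hg : ConvexOn ℝ Q g) (hne : Q.Nonempty) (hQ : Bornology.IsBounded Q) :
    ∃ B, ∀ α ∈ Q, B ≤ g α := by
  obtain ⟨y, hy⟩ := Set.Nonempty.intrinsicInterior hg.1 hne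
  obtain ⟨s, hs⟩ := exists_mem_subdiffOn hg hy
  obtain ⟨R, hR⟩ := hQ.subset_closedBall y
  refine ⟨g y - ‖s‖ * R, fun x hx => ?_⟩
  have h1 := hs x hx
  have h2 := (neg_abs_le _).trans' (neg_le_neg (s.le_opNorm (x - y)))
  have h3 : ‖s‖ * ‖x - y‖ ≤ ‖s‖ * R := by
    gcongr; exact mem_closedBall_iff_norm.1 (hR hx)
  linarith

theorem StrongConvexOn.isBounded_of_le {Q : Set F} {σ D : ℝ} {d : F → ℝ}
    (hd : StrongConvexOn Q σ d) (hσ : 0 < σ) (h0 : IsLeast (d '' Q) 0)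
    (hD : ∀ x ∈ Q, d x ≤ D) : Bornology.IsBounded Q := by
  obtain ⟨z, hz, hz0⟩ := h0.1
  have hmin : IsMinOn d Q z := fun x hx => by
    show d z ≤ d x
    rw [hz0]; exact h0.2 ⟨x, hx, rfl⟩
  refine (Metric.isBounded_closedBall (x := z) (r := √(2 * D / σ))).subset fun x hx => ?_
  have h1 := StrongConvexOn.add_sq_le_of_isMinOn hd hz hmin hx
  have h2 := hD x hx
  rw [mem_closedBall_iff_norm]
  refine Real.le_sqrt_of_sq_le ?_
  rw [le_div_iff₀ hσ]
  linarith

theorem fenchelOn_le_add {Q : Set F} (hne : Q.Nonempty) {g G : F → ℝ} {δ : ℝ}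
    (h : ∀ α ∈ Q, G α ≤ g α + δ) (u : StrongDual ℝ F)
    (hb : BddAbove ((fun α => u α - G α) '' Q)) :
    fenchelOn Q g u ≤ fenchelOn Q G u + δ := by
  refine csSup_le (hne.image _) ?_
  rintro _ ⟨α, hα, rfl⟩
  have h1 : u α - G α ≤ fenchelOn Q G u := le_csSup hb ⟨α, hα, rfl⟩
  have h2 := h α hα
  simp only
  linarith

end Smoothing

/-! ### Estimate functions and the invariant of the accelerated method -/

section Method

variable {E : Type*} [NormedAddCommGroup E] [NormedSpace ℝ E]

theorem exists_pos_root {c lam S : ℝ} (hc : 0 < c) (hlam : 0 ≤ lam) (hS : 0 ≤ S) :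
    ∃ a : ℝ, 0 < a ∧ (a + S) * (lam * S + 1) + a * lam * S = c * a ^ 2 := by
  -- The equation reads `c a² = b a + e` with `b > 0` and `e ≥ 0`; the larger root is taken.
  set b := 2 * (lam * S) + 1 with hb
  set e := S * (lam * S + 1) with he
  have hlS : 0 ≤ lam * S := mul_nonneg hlam hS
  have hb0 : 0 < b := by positivity
  have he0 : 0 ≤ e := by positivity
  set r := √(b ^ 2 + 4 * c * e) with hr
  have hr2 : r ^ 2 = b ^ 2 + 4 * c * e := Real.sq_sqrt (by positivity)
  refine ⟨(b + r) / (2 * c), by positivity, ?_⟩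
  have h1 : c * ((b + r) / (2 * c)) ^ 2 = b * ((b + r) / (2 * c)) + e := by
    field_simp
    linear_combination hr2
  rw [h1, hb, he]
  ring

theorem estimate_eq_affine (d f Ω : E → ℝ) (x₀ : E) (u : ℕ → E) {a S : ℕ → ℝ} (hS0 : S 0 = 0)
    (hS : ∀ k, S (k + 1) = S k + a (k + 1)) (k : ℕ) :
    ∃ (l : StrongDual ℝ E) (c : ℝ), ∀ x,
      estimate d f Ω 0 x₀ u a k x = d x + S k * Ω x + l x + c := by
  induction k with
  | zero =>
    refine ⟨-fderiv ℝ d x₀, fderiv ℝ d x₀ x₀ - d x₀, fun x => ?_⟩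
    simp only [estimate, bregman, hS0, map_sub, neg_apply]
    ring
  | succ k ih =>
    obtain ⟨l, c, h⟩ := ih
    refine ⟨l + a (k + 1) • fderiv ℝ f (u (k + 1)),
      c + a (k + 1) * (f (u (k + 1)) - fderiv ℝ f (u (k + 1)) (u (k + 1))), fun x => ?_⟩
    simp only [estimate, lowerModel, h, hS, map_sub, add_apply, smul_apply, smul_eq_mul]
    ring

theorem estimate_le {d f Ω : E → ℝ} (hgrad : ∀ x y, f x + fderiv ℝ f x (y - x) ≤ f y)
    (x₀ : E) (u : ℕ → E) {a S : ℕ → ℝ} (hS0 : S 0 = 0) (ha : ∀ k, 0 < a (k + 1))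
    (hS : ∀ k, S (k + 1) = S k + a (k + 1)) (k : ℕ) (x : E) :
    estimate d f Ω 0 x₀ u a k x ≤ bregman d x x₀ + S k * (f x + Ω x) := by
  induction k with
  | zero => simp [estimate, hS0]
  | succ k ih =>
    have h1 := mul_le_mul_of_nonneg_left (hgrad (u (k + 1)) x) (ha k).le
    simp only [estimate, lowerModel, hS]
    linear_combination ih + h1

theorem strongConvexOn_of_eq_affine {Q : Set E} {σ lam S : ℝ} {d Ω ψ : E → ℝ}
    (hd : StrongConvexOn Q σ d) (hh : ConvexOn ℝ Q fun x => Ω x - lam * d x) (hlam : 0 ≤ lam)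
    (hS : 0 ≤ S) (hψ : ∃ (l : StrongDual ℝ E) (c : ℝ), ∀ x, ψ x = d x + S * Ω x + l x + c) :
    StrongConvexOn Q ((1 + lam * S) * σ) ψ := by
  obtain ⟨l, c, h⟩ := hψ
  refine strongConvexOn_comb hd hh (by positivity) hS l c fun x => ?_
  rw [h]; ring

theorem LowerSemicontinuousOn.of_eq_affine {Q : Set E} {S : ℝ} {d Ω ψ : E → ℝ}
    (hd : LowerSemicontinuousOn d Q) (hΩ : LowerSemicontinuousOn Ω Q) (hS : 0 ≤ S)
    (hψ : ∃ (l : StrongDual ℝ E) (c : ℝ), ∀ x, ψ x = d x + S * Ω x + l x + c) :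
    LowerSemicontinuousOn ψ Q := by
  obtain ⟨l, c, h⟩ := hψ
  have h1 : LowerSemicontinuousOn (fun x => S * Ω x) Q :=
    Continuous.comp_lowerSemicontinuousOn (g := fun t => S * t) (by fun_prop) hΩ
      (monotone_mul_left_of_nonneg hS)
  have h2 : LowerSemicontinuousOn (fun x => l x + c) Q :=
    (Continuous.lowerSemicontinuous (by fun_prop)).lowerSemicontinuousOn Q
  have h3 := (hd.add h1).add h2
  have h4 : ψ = fun x => d x + S * Ω x + (l x + c) := by
    funext x; rw [h]; ring
  rw [h4]; exact h3

section Run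

variable {Q : Set E} {d f Ω : E → ℝ} {σ L lam : ℝ} {x z u : ℕ → E} {a S : ℕ → ℝ}

theorem IsAGMRun.S_nonneg (h : IsAGMRun Q d f Ω σ L 0 lam x z u a S) (k : ℕ) : 0 ≤ S k := by
  induction k with
  | zero => exact h.S_zero.ge
  | succ k ih => rw [h.S_succ]; exact add_nonneg ih (h.a_pos k).le

theorem IsAGMRun.S_succ_pos (h : IsAGMRun Q d f Ω σ L 0 lam x z u a S) (k : ℕ) :
    0 < S (k + 1) := by
  rw [h.S_succ]; exact add_pos_of_nonneg_of_pos (h.S_nonneg k) (h.a_pos k)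

theorem IsAGMRun.z_mem' (h : IsAGMRun Q d f Ω σ L 0 lam x z u a S) (k : ℕ) : z k ∈ Q := by
  cases k with
  | zero => rw [h.z_zero]; exact h.x_zero_mem
  | succ k => exact h.z_mem k

theorem average_mem (hQ : Convex ℝ Q) {x y : E} (hx : x ∈ Q) (hy : y ∈ Q) {p q s : ℝ}
    (hp : 0 ≤ p) (hq : 0 ≤ q) (hs : 0 < s) (hpq : p + q = s) :
    s⁻¹ • (p • x + q • y) ∈ Q := by
  rw [smul_add, smul_smul, smul_smul]
  refine hQ hx hy (by positivity) (by positivity) ?_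
  rw [← mul_add, hpq, inv_mul_cancel₀ hs.ne']

theorem IsAGMRun.x_mem (h : IsAGMRun Q d f Ω σ L 0 lam x z u a S) (hQ : Convex ℝ Q) (k : ℕ) :
    x k ∈ Q := by
  induction k with
  | zero => exact h.x_zero_mem
  | succ k ih =>
    rw [h.x_succ]
    exact average_mem hQ ih (h.z_mem k) (h.S_nonneg k) (h.a_pos k).le (h.S_succ_pos k)
      (h.S_succ k).symm

/-- Convexity of the square with weights `τ₁`, `τ₃`, combined with the root equation: the smoothness
error at `v = x_{k+1} - u_{k+1}` is paid for by the strong convexity gains at `p = z_{k+1} - z_k`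
and `q = z_{k+1} - x_k`. -/
theorem sq_norm_le_of_smul_eq {p q v : E} {a s τ₁ τ₃ : ℝ} (ha : 0 ≤ a) (hs : 0 < s)
    (hτ₁ : 0 < τ₁) (hτ₃ : 0 ≤ τ₃) (hL : 0 ≤ L) (hroot : σ * ((τ₁ + τ₃) * s) = L * a ^ 2)
    (hv : ((τ₁ + τ₃) * s) • v = a • (τ₁ • p + τ₃ • q)) (hσ : 0 ≤ σ) :
    s * (L * ‖v‖ ^ 2) ≤ σ * (τ₁ * ‖p‖ ^ 2 + τ₃ * ‖q‖ ^ 2) := by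
  set τ := τ₁ + τ₃ with hτ
  have hτ0 : 0 < τ := by positivity
  have h1 : τ * s * ‖v‖ ≤ a * (τ₁ * ‖p‖ + τ₃ * ‖q‖) := by
    have e := congrArg norm hv
    rw [norm_smul, norm_smul, Real.norm_of_nonneg (by positivity), Real.norm_of_nonneg ha] at e
    rw [e]
    gcongr
    refine (norm_add_le _ _).trans_eq ?_
    rw [norm_smul, norm_smul, Real.norm_of_nonneg hτ₁.le, Real.norm_of_nonneg hτ₃]
  have h2 : (τ * s * ‖v‖) ^ 2 ≤ (a * (τ₁ * ‖p‖ + τ₃ * ‖q‖)) ^ 2 := by gcongr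
  have h3 : (τ₁ * ‖p‖ + τ₃ * ‖q‖) ^ 2 ≤ τ * (τ₁ * ‖p‖ ^ 2 + τ₃ * ‖q‖ ^ 2) := by
    have : 0 ≤ τ₁ * τ₃ * (‖p‖ - ‖q‖) ^ 2 := by positivity
    rw [hτ]
    linear_combination this
  have h4 := mul_le_mul_of_nonneg_left h2 hL
  have h5 := mul_le_mul_of_nonneg_left h3 (show 0 ≤ σ * (τ * s) by positivity)
  have h6 : τ ^ 2 * s * (s * (L * ‖v‖ ^ 2)) ≤
      τ ^ 2 * s * (σ * (τ₁ * ‖p‖ ^ 2 + τ₃ * ‖q‖ ^ 2)) := by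
    linear_combination h4 + h5 - (τ₁ * ‖p‖ + τ₃ * ‖q‖) ^ 2 * hroot
  exact le_of_mul_le_mul_left h6 (by positivity)

/-- Passing from `k` to `k + 1`, the growth of `ψ_k` about `z_k` gains `σ τ₁ / 2 * ‖z_{k+1} - z_k‖²`
and strong convexity of `Ω` gains `σ τ₃ / 2 * ‖z_{k+1} - x_k‖²`. By `sq_norm_le_of_smul_eq` they
cover the error of the descent inequality at `u_{k+1}`. Minimality of `z k` is part of the induction
because at `k = 0` it comes from convexity of `d`, not from the run. -/
theorem IsAGMRun.mul_le_estimate (h : IsAGMRun Q d f Ω σ L 0 lam x z u a S)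
    (hσ : 0 < σ) (hL : 0 < L) (hlam : 0 ≤ lam) (hd : StrongConvexOn Q σ d)
    (hdiff : DifferentiableAt ℝ d (x 0))
    (hh : ConvexOn ℝ Q fun x => Ω x - lam * d x)
    (hgrad : ∀ x y, f x + fderiv ℝ f x (y - x) ≤ f y) (hf : IsLcgOn Q L f) (k : ℕ) :
    IsMinOn (estimate d f Ω 0 (x 0) u a k) Q (z k) ∧
      S k * (f (x k) + Ω (x k)) ≤ estimate d f Ω 0 (x 0) u a k (z k) := by
  have hQ := hd.1
  have hdc : ConvexOn ℝ Q d := hd.convexOn fun r => by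
    simp only [Pi.zero_apply]; positivity
  have hΩ : StrongConvexOn Q (lam * σ) Ω :=
    strongConvexOn_comb hd hh hlam zero_le_one 0 0 fun x => by simp
  induction k with
  | zero =>
    have h0 : bregman d (x 0) (x 0) = 0 := by simp [bregman]
    refine ⟨fun y hy => ?_, ?_⟩
    · have := ConvexOn.fderiv_sub_le hdc hy h.x_zero_mem hdiff
      show bregman d (z 0) (x 0) ≤ bregman d y (x 0)
      rw [h.z_zero, h0]
      unfold bregman; linarith
    · rw [h.S_zero, zero_mul, h.z_zero]
      exact h0.ge
  | succ k ih =>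
    refine ⟨h.z_min k, ?_⟩
    obtain ⟨hmin, hle⟩ := ih
    have hSk := h.S_nonneg k
    have hS1 := h.S_succ_pos k
    have ha := h.a_pos k
    have hxk := h.x_mem hQ k
    have hxk1 := h.x_mem hQ (k + 1)
    have hzk := h.z_mem' k
    have hzk1 := h.z_mem k
    have hSs := h.S_succ k
    have hsc := strongConvexOn_of_eq_affine hd hh hlam hSk
      (estimate_eq_affine d f Ω (x 0) u h.S_zero h.S_succ k)
    have hgrowth := StrongConvexOn.add_sq_le_of_isMinOn hsc hzk hmin hzk1
    have hroot := h.a_root k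
    have hu := h.u_succ k _ _ _ _ rfl rfl rfl rfl
    have hx1 := h.x_succ k
    simp only [zero_mul, zero_add, add_zero, sub_zero] at hroot hu
    set S0 := S k
    set S1 := S (k + 1) with hS1def
    set α := a (k + 1)
    set τ₁ := 1 + lam * S0 with hτ₁
    set τ₃ := lam * α * (S0 / S1) with hτ₃
    have hτ₁0 : 0 < τ₁ := by positivity
    have hτ₃0 : 0 ≤ τ₃ := by positivity
    have hτ0 : 0 < (τ₁ + τ₃) * S1 := by positivity
    have hτ₃S : τ₃ * S1 = lam * α * S0 := by rw [hτ₃]; field_simp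
    have hroot' : σ * ((τ₁ + τ₃) * S1) = L * α ^ 2 := by
      have e : (τ₁ + τ₃) * S1 = L * σ⁻¹ * α ^ 2 := by
        rw [← hroot, add_mul, hτ₃S, hSs, hτ₁]; ring
      rw [e]; field_simp
    have hx1' : S1 • x (k + 1) = S0 • x k + α • z (k + 1) := by
      rw [hx1, smul_inv_smul₀ hS1.ne']
    have hu' : ((τ₁ + τ₃) * S1) • u (k + 1) =
        (α * τ₁) • z k + ((τ₁ + τ₃) * S0 + τ₃ * α) • x k := by
      rw [hu, smul_inv_smul₀ hτ0.ne']
    have huQ : u (k + 1) ∈ Q := by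
      rw [hu]
      exact average_mem hQ hzk hxk (by positivity) (by positivity) hτ0 (by rw [hSs]; ring)
    -- The weights defining `u_{k+1}` are exactly those that make this identity hold.
    have hv : ((τ₁ + τ₃) * S1) • (x (k + 1) - u (k + 1)) =
        α • (τ₁ • (z (k + 1) - z k) + τ₃ • (z (k + 1) - x k)) := by
      rw [smul_sub, hu', mul_smul, hx1']; module
    have hnorm := sq_norm_le_of_smul_eq ha.le hS1 hτ₁0 hτ₃0 hL.le hroot' hv hσ.le
    have hdesc := mul_le_mul_of_nonneg_left (hf.le_add_sq hQ huQ hxk1) hS1.le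
    have hconv : S1 * Ω (x (k + 1)) ≤ S0 * Ω (x k) + α * Ω (z (k + 1))
        - σ / 2 * τ₃ * ‖z (k + 1) - x k‖ ^ 2 := by
      have e := hΩ.2 hxk hzk1 (show 0 ≤ S0 / S1 by positivity) (show 0 ≤ α / S1 by positivity)
        (by rw [← add_div, ← hSs, div_self hS1.ne'])
      have e2 : (S0 / S1) • x k + (α / S1) • z (k + 1) = x (k + 1) := by
        rw [hx1, smul_add, smul_smul, smul_smul, div_eq_inv_mul, div_eq_inv_mul]
      rw [e2, norm_sub_rev] at e
      have e3 := mul_le_mul_of_nonneg_left e hS1.le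
      simp only [smul_eq_mul] at e3
      refine e3.trans_eq ?_
      rw [hτ₃]; field_simp
    have hlin : S1 * fderiv ℝ f (u (k + 1)) (x (k + 1) - u (k + 1)) =
        S0 * fderiv ℝ f (u (k + 1)) (x k - u (k + 1))
          + α * fderiv ℝ f (u (k + 1)) (z (k + 1) - u (k + 1)) := by
      have e := congrArg (fderiv ℝ f (u (k + 1))) hx1'
      simp only [map_add, map_smul, smul_eq_mul] at e
      simp only [map_sub]
      linear_combination e - fderiv ℝ f (u (k + 1)) (u (k + 1)) * hSs
    have hlow := mul_le_mul_of_nonneg_left (hgrad (u (k + 1)) (x k)) hSk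
    simp only [estimate, lowerModel, zero_mul, add_zero]
    linear_combination hle + hgrowth + hdesc + hconv + hlow + hnorm / 2 + hlin
      + f (u (k + 1)) * hSs

theorem IsAGMRun.mul_sub_le (h : IsAGMRun Q d f Ω σ L 0 lam x z u a S)
    (hσ : 0 < σ) (hL : 0 < L) (hlam : 0 ≤ lam) (hd : StrongConvexOn Q σ d)
    (hdiff : DifferentiableAt ℝ d (x 0))
    (hh : ConvexOn ℝ Q fun x => Ω x - lam * d x)
    (hgrad : ∀ x y, f x + fderiv ℝ f x (y - x) ≤ f y) (hf : IsLcgOn Q L f) (k : ℕ)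
    {y : E} (hy : y ∈ Q) :
    S k * (f (x k) + Ω (x k)) ≤ bregman d y (x 0) + S k * (f y + Ω y) := by
  obtain ⟨h1, h2⟩ := h.mul_le_estimate hσ hL hlam hd hdiff hh hgrad hf k
  exact h2.trans ((h1 hy).trans (estimate_le hgrad (x 0) u h.S_zero h.a_pos h.S_succ k y))

end Run

/-! ### Growth of the accumulated step sizes -/

section Growth

variable {lam C : ℝ} {a S : ℕ → ℝ}

theorem nonneg_of_recursion (hS0 : S 0 = 0) (ha : ∀ k, 0 < a (k + 1))
    (hS : ∀ k, S (k + 1) = S k + a (k + 1)) (k : ℕ) : 0 ≤ S k := by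
  induction k with
  | zero => exact hS0.ge
  | succ k ih => rw [hS]; exact add_nonneg ih (ha k).le

/-- Factor `a_{k+1}` as a difference of squares of `√S`: since `√S_{k+1} ≤ √C a_{k+1}`, each step
raises `√S` by at least `1 / (2√C)`. -/
theorem le_sqrt_of_recursion (hC : 0 < C) (hS0 : S 0 = 0) (ha : ∀ k, 0 < a (k + 1))
    (hS : ∀ k, S (k + 1) = S k + a (k + 1)) (hroot : ∀ k, S (k + 1) ≤ C * a (k + 1) ^ 2) (k : ℕ) :
    k * (1 / (2 * √C)) ≤ √(S k) := by
  have hSn := nonneg_of_recursion hS0 ha hS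
  induction k with
  | zero => simp
  | succ k ih =>
    have hC' := Real.sqrt_pos.2 hC
    have hp0 : 0 < √(S (k + 1)) := Real.sqrt_pos.2 (by linarith [hS k, hSn k, ha k])
    have hp : √(S (k + 1)) ≤ √C * a (k + 1) := by
      refine (Real.sqrt_le_sqrt (hroot k)).trans_eq ?_
      rw [Real.sqrt_mul hC.le, Real.sqrt_sq (ha k).le]
    have hsp : √(S k) ≤ √(S (k + 1)) := Real.sqrt_le_sqrt (by linarith [hS k, ha k])
    have h1 : a (k + 1) = (√(S (k + 1)) - √(S k)) * (√(S (k + 1)) + √(S k)) := by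
      have e1 := Real.sq_sqrt (hSn k)
      have e2 := Real.sq_sqrt (hSn (k + 1))
      linear_combination e1 - e2 - hS k
    have h2 : √(S (k + 1)) * 1 ≤ √(S (k + 1)) * (2 * √C * (√(S (k + 1)) - √(S k))) := by
      have h3 : a (k + 1) ≤ (√(S (k + 1)) - √(S k)) * (2 * √(S (k + 1))) := by
        rw [h1]
        exact mul_le_mul_of_nonneg_left (by linarith) (by linarith)
      have h4 := mul_le_mul_of_nonneg_left h3 hC'.le
      linarith
    have h3 := le_of_mul_le_mul_left h2 hp0
    have h4 : 1 / (2 * √C) ≤ √(S (k + 1)) - √(S k) := by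
      rw [div_le_iff₀ (by positivity)]; linarith
    push_cast
    linarith

/-- Keeping only the `lam S_k` term of the recursion, the same factorization gives `√S_{k+1} - √S_k
≥ √(lam / (4C)) √S_k`. The first step gives `S_1 ≥ 1 / C`, so the geometric growth starts at index
`1`. -/
theorem pow_le_sqrt_of_recursion (hC : 0 < C) (hlam : 0 ≤ lam) (hS0 : S 0 = 0)
    (ha : ∀ k, 0 < a (k + 1)) (hS : ∀ k, S (k + 1) = S k + a (k + 1))
    (hroot : ∀ k, S (k + 1) * (lam * S k + 1) ≤ C * a (k + 1) ^ 2) (k : ℕ) :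
    1 / √C * (1 + √(lam / (4 * C))) ^ k ≤ √(S (k + 1)) := by
  have hSn := nonneg_of_recursion hS0 ha hS
  have hC' := Real.sqrt_pos.2 hC
  induction k with
  | zero =>
    have h1 : S (0 + 1) = a (0 + 1) := by rw [hS, hS0, zero_add]
    have h0 : a (0 + 1) ≤ C * a (0 + 1) ^ 2 := by
      have h := hroot 0
      rw [hS0, h1] at h
      linarith
    have h2 : 1 ≤ C * a (0 + 1) := by
      have : 1 * a (0 + 1) ≤ C * a (0 + 1) * a (0 + 1) := by linarith
      exact le_of_mul_le_mul_right this (ha 0)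
    rw [pow_zero, mul_one, h1, ← Real.sqrt_one, ← Real.sqrt_div zero_le_one]
    refine Real.sqrt_le_sqrt ?_
    rw [div_le_iff₀ hC]
    linarith
  | succ k ih =>
    set r := √(lam / (4 * C)) with hr
    have hr0 : 0 ≤ r := Real.sqrt_nonneg _
    have hr2 : lam = 4 * C * r ^ 2 := by
      rw [hr, Real.sq_sqrt (by positivity)]; field_simp
    set s := √(S (k + 1)) with hs
    set p := √(S (k + 1 + 1)) with hp
    have e1 : s ^ 2 = S (k + 1) := Real.sq_sqrt (hSn _)
    have e2 : p ^ 2 = S (k + 1 + 1) := Real.sq_sqrt (hSn _)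
    have hs0 : 0 ≤ s := Real.sqrt_nonneg _
    have hp0 : 0 < p := Real.sqrt_pos.2 (by linarith [hS (k + 1), hSn (k + 1), ha (k + 1)])
    have hsp : s ≤ p := Real.sqrt_le_sqrt (by linarith [hS (k + 1), ha (k + 1)])
    have h1 : a (k + 1 + 1) = (p - s) * (p + s) := by
      linear_combination e1 - e2 - hS (k + 1)
    have h2 : (2 * r * s * p) ^ 2 ≤ a (k + 1 + 1) ^ 2 := by
      have h3 := hroot (k + 1)
      rw [← e1, ← e2] at h3
      have h4 : C * (2 * r * s * p) ^ 2 ≤ C * a (k + 1 + 1) ^ 2 := by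
        have e : C * (2 * r * s * p) ^ 2 = p ^ 2 * (lam * s ^ 2) := by rw [hr2]; ring
        rw [e]
        nlinarith [sq_nonneg p]
      exact le_of_mul_le_mul_left h4 hC
    have h3 : 2 * r * s * p ≤ a (k + 1 + 1) :=
      (pow_le_pow_iff_left₀ (by positivity) (ha _).le two_ne_zero).1 h2
    have h4 : a (k + 1 + 1) ≤ (p - s) * (2 * p) := by
      rw [h1]
      exact mul_le_mul_of_nonneg_left (by linarith) (by linarith)
    have h5 : r * s ≤ p - s := by
      have : (2 * p) * (r * s) ≤ (2 * p) * (p - s) := by linarith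
      exact le_of_mul_le_mul_left this (by positivity)
    calc 1 / √C * (1 + r) ^ (k + 1) = (1 / √C * (1 + r) ^ k) * (1 + r) := by ring
      _ ≤ s * (1 + r) := by gcongr
      _ ≤ p := by linarith

/-- The two growth rates of `S`, in terms of the number of iterations. -/
theorem div_le_of_recursion (hC : 0 < C) (hlam : 0 ≤ lam) (hS0 : S 0 = 0)
    (ha : ∀ k, 0 < a (k + 1)) (hS : ∀ k, S (k + 1) = S k + a (k + 1))
    (hroot : ∀ k, S (k + 1) * (lam * S k + 1) ≤ C * a (k + 1) ^ 2) {k : ℕ} (hk : 1 ≤ k)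
    {T : ℝ} (hT : 0 ≤ T)
    (hbound : √(4 * C * T) ≤ k ∨ 0 < lam ∧
      1 + 1 / 2 * Real.log (4 * C * T) / Real.log (1 + √(lam / (4 * C))) ≤ k) :
    T ≤ S k := by
  have hSn := nonneg_of_recursion hS0 ha hS
  -- `T = 0` is set aside because comparing logarithms below needs `T > 0`.
  rcases hT.eq_or_lt with rfl | hT
  · exact hSn k
  rcases hbound with hb | ⟨hlam0, hb⟩
  · have h1 := le_sqrt_of_recursion hC hS0 ha hS (fun j => (hroot j).trans' (by
      have := mul_nonneg (hSn (j + 1)) (mul_nonneg hlam (hSn j))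
      linarith)) k
    have h2 := mul_le_mul_of_nonneg_right hb (show 0 ≤ 1 / (2 * √C) by positivity)
    have h3 : √(4 * C * T) * (1 / (2 * √C)) = √T := by
      have hC' := Real.sqrt_pos.2 hC
      rw [Real.sqrt_mul (by positivity), Real.sqrt_mul (by positivity),
        show (4 : ℝ) = 2 ^ 2 by norm_num, Real.sqrt_sq zero_le_two]
      field_simp
    rw [h3] at h2
    exact (Real.sqrt_le_sqrt_iff (hSn k)).1 (h2.trans h1)
  -- The shift `k = j + 1` absorbs the leading `1` in the bound, as geometric growth starts from `S
  -- 1`.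
  · obtain ⟨j, rfl⟩ := Nat.exists_eq_add_of_le' hk
    have h1 := pow_le_sqrt_of_recursion hC hlam hS0 ha hS hroot j
    set r := √(lam / (4 * C)) with hr
    have hr0 : 0 < r := Real.sqrt_pos.2 (by positivity)
    have hlog : 0 < Real.log (1 + r) := Real.log_pos (by linarith)
    have hb' : 1 / 2 * Real.log (4 * C * T) / Real.log (1 + r) ≤ j := by
      push_cast at hb; linarith
    rw [div_le_iff₀ hlog] at hb'
    have h2 : Real.log (4 * C * T) ≤ Real.log (((1 + r) ^ j) ^ 2) := by
      rw [Real.log_pow, Real.log_pow]; push_cast; linarith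
    have h3 := (Real.log_le_log_iff (by positivity) (by positivity)).1 h2
    have h4 : (1 / √C * (1 + r) ^ j) ^ 2 ≤ S (j + 1) := by
      rw [← Real.sq_sqrt (hSn (j + 1))]; gcongr
    rw [mul_pow, div_pow, Real.sq_sqrt hC.le, one_pow, one_div, inv_mul_le_iff₀ hC] at h4
    have h5 : C * T ≤ C * S (j + 1) := by nlinarith
    exact le_of_mul_le_mul_left h5 hC

end Growth

/-! ### Existence of a run -/

section Existence

/-- One step of the method: the current points, the step size, the accumulated step sizes and the
current estimate function. -/
structure AGMState (E : Type*) where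
  x : E
  z : E
  u : E
  a : ℝ
  S : ℝ
  ψ : E → ℝ

/-- The invariant of the method. -/
structure AGMState.Valid (Q : Set E) (d Ω : E → ℝ) (s : AGMState E) : Prop where
  x_mem : s.x ∈ Q
  z_mem : s.z ∈ Q
  S_nonneg : 0 ≤ s.S
  affine : ∃ (l : StrongDual ℝ E) (c : ℝ), ∀ x, s.ψ x = d x + s.S * Ω x + l x + c

/-- `t` is obtained from `s` by one iteration of the method. -/
structure AGMState.IsNext (Q : Set E) (d f Ω : E → ℝ) (σ L lam : ℝ) (s t : AGMState E) : Prop where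
  a_pos : 0 < t.a
  a_root : (t.a + s.S) * (lam * s.S + 1) + t.a * lam * s.S = L * σ⁻¹ * t.a ^ 2
  S_eq : t.S = s.S + t.a
  u_eq : ∀ τ₁ τ₃ : ℝ, τ₁ = 1 + lam * s.S → τ₃ = lam * t.a * (s.S / t.S) →
    t.u = ((τ₁ + τ₃) * t.S)⁻¹ •
      ((t.a * τ₁) • s.z + ((τ₁ + τ₃) * s.S + τ₃ * t.a) • s.x)
  ψ_eq : t.ψ = fun x => s.ψ x + t.a * (Ω x + lowerModel d f 0 x t.u)
  z_min : IsMinOn t.ψ Q t.z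
  x_eq : t.x = t.S⁻¹ • (s.S • s.x + t.a • t.z)

theorem AGMState.Valid.exists_isNext [FiniteDimensional ℝ E] {Q : Set E} {d f Ω : E → ℝ}
    {σ L lam : ℝ} (hQ : IsClosed Q) (hd : IsProxOn Q σ d) (hΩ : LowerSemicontinuousOn Ω Q)
    (hh : ConvexOn ℝ Q fun x => Ω x - lam * d x) (hlam : 0 ≤ lam) (hL : 0 < L)
    {s : AGMState E} (hs : s.Valid Q d Ω) :
    ∃ t : AGMState E, t.Valid Q d Ω ∧ s.IsNext Q d f Ω σ L lam t := by
  have hσ := hd.modulus_pos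
  have hS := hs.S_nonneg
  obtain ⟨a, ha, hroot⟩ := exists_pos_root (c := L * σ⁻¹) (by positivity) hlam hS
  set S' := s.S + a with hS'
  have hS0 : 0 < S' := by positivity
  set τ₁ := 1 + lam * s.S with hτ₁
  set τ₃ := lam * a * (s.S / S') with hτ₃
  set u := ((τ₁ + τ₃) * S')⁻¹ • ((a * τ₁) • s.z + ((τ₁ + τ₃) * s.S + τ₃ * a) • s.x) with hu
  set ψ : E → ℝ := fun x => s.ψ x + a * (Ω x + lowerModel d f 0 x u) with hψ
  have haff : ∃ (l : StrongDual ℝ E) (c : ℝ), ∀ x, ψ x = d x + S' * Ω x + l x + c := by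
    obtain ⟨l, c, h⟩ := hs.affine
    refine ⟨l + a • fderiv ℝ f u, c + a * (f u - fderiv ℝ f u u), fun x => ?_⟩
    simp only [hψ, lowerModel, h, hS', map_sub, add_apply, smul_apply, smul_eq_mul]
    ring
  obtain ⟨z, hz, hzmin⟩ := StrongConvexOn.exists_isMinOn
    (strongConvexOn_of_eq_affine hd.strongConvex hh hlam hS0.le haff) (by positivity)
    (LowerSemicontinuousOn.of_eq_affine hd.lsc hΩ hS0.le haff) hQ ⟨s.x, hs.x_mem⟩
  refine ⟨⟨S'⁻¹ • (s.S • s.x + a • z), z, u, a, S', ψ⟩, ⟨?_, hz, hS0.le, haff⟩,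
    ⟨ha, hroot, rfl, ?_, rfl, hzmin, rfl⟩⟩
  · exact average_mem hd.strongConvex.1 hs.x_mem hz hS ha.le hS0 rfl
  · rintro _ _ rfl rfl; rfl

theorem exists_isAGMRun [FiniteDimensional ℝ E] {Q : Set E} {d f Ω : E → ℝ}
    {σ L lam : ℝ} (hQ : IsClosed Q) (hd : IsProxOn Q σ d) (hΩ : LowerSemicontinuousOn Ω Q)
    (hh : ConvexOn ℝ Q fun x => Ω x - lam * d x) (hlam : 0 ≤ lam) (hL : 0 < L)
    {u₀ : E} (hu₀ : u₀ ∈ Q) :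
    ∃ (x z u : ℕ → E) (a S : ℕ → ℝ), IsAGMRun Q d f Ω σ L 0 lam x z u a S ∧ x 0 = u₀ := by
  have hstep : ∀ s : {s : AGMState E // s.Valid Q d Ω}, ∃ t : {s : AGMState E // s.Valid Q d Ω},
      s.1.IsNext Q d f Ω σ L lam t.1 := fun s => by
    obtain ⟨t, ht, hst⟩ := s.2.exists_isNext (f := f) hQ hd hΩ hh hlam hL
    exact ⟨⟨t, ht⟩, hst⟩
  choose next hnext using hstep
  -- The initial entries for `u` and `a` are placeholders: the recursion reads these sequences only
  -- from index `1` on.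
  have hvalid : (⟨u₀, u₀, u₀, 0, 0, fun x => bregman d x u₀⟩ : AGMState E).Valid Q d Ω := by
    refine ⟨hu₀, hu₀, le_rfl, -fderiv ℝ d u₀, fderiv ℝ d u₀ u₀ - d u₀, fun x => ?_⟩
    simp only [bregman, map_sub, neg_apply]
    ring
  let s : ℕ → {s : AGMState E // s.Valid Q d Ω} := fun n => Nat.rec ⟨_, hvalid⟩ (fun _ => next) n
  have hs : ∀ k, (s k).1.IsNext Q d f Ω σ L lam (s (k + 1)).1 := fun k => hnext (s k)
  have hest : ∀ k, estimate d f Ω 0 u₀ (fun k => (s k).1.u) (fun k => (s k).1.a) k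
      = (s k).1.ψ := by
    intro k
    induction k with
    | zero => rfl
    | succ k ih =>
      rw [(hs k).ψ_eq, ← ih]
      rfl
  refine ⟨fun k => (s k).1.x, fun k => (s k).1.z, fun k => (s k).1.u, fun k => (s k).1.a,
    fun k => (s k).1.S, ⟨hu₀, rfl, rfl, fun k => (hs k).a_pos, fun k => ?_, fun k => (hs k).S_eq,
      fun k => ?_, fun k => (s (k + 1)).2.z_mem, fun k => ?_, fun k => (hs k).x_eq⟩, rfl⟩
  · rw [← (hs k).a_root]; ring
  · rintro τ₁ τ₂ τ₃ τ h1 rfl h3 rfl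
    simp only [zero_mul, zero_add, add_zero, sub_zero] at h1 ⊢
    exact (hs k).u_eq τ₁ τ₃ h1 h3
  · have := (hs k).z_min
    rwa [← hest (k + 1)] at this

end Existence

end Method

end AccGrad

/-! ### The complexity bound for the smoothed problem -/

theorem mainTheorem5
    {E₁ E₂ : Type*}
    [NormedAddCommGroup E₁] [NormedSpace ℝ E₁] [FiniteDimensional ℝ E₁]
    [NormedAddCommGroup E₂] [NormedSpace ℝ E₂] [FiniteDimensional ℝ E₂]
    -- the regularizer `Ω` on the closed convex set `Q₁`, and the prox-function `d₁`
    (Q₁ : Set E₁) (hQ₁ : IsClosed Q₁)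
    (d₁ : E₁ → ℝ) (σ₁ : ℝ) (hd₁ : AccGrad.IsProxOn Q₁ σ₁ d₁)
    (Ω : E₁ → ℝ) (hΩ : LowerSemicontinuousOn Ω Q₁)
    (lam : ℝ) (hlam : 0 ≤ lam) (hΩsc : AccGrad.IsScWrt Q₁ lam d₁ Ω)
    -- the function `g` with closed convex domain `Q₂`, and the smoothing function `d₂`
    (Q₂ : Set E₂) (hQ₂ : IsClosed Q₂) (g : E₂ → ℝ) (hg : ConvexOn ℝ Q₂ g)
    (d₂ : E₂ → ℝ) (σ₂ : ℝ) (hσ₂ : 0 < σ₂) (hd₂ : StrongConvexOn Q₂ σ₂ d₂)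
    (hd₂min : IsLeast (d₂ '' Q₂) 0)
    (D : ℝ) (hD : IsGreatest (d₂ '' Q₂) D) (hDpos : 0 < D)
    -- the linear model, the objective and its minimizer
    (A : E₁ →L[ℝ] StrongDual ℝ E₂)
    (J : E₁ → ℝ) (hJ : J = fun w => Ω w + AccGrad.fenchelOn Q₂ g (A w))
    (wstar : E₁) (hwstar : wstar ∈ Q₁) (hmin : IsMinOn J Q₁ wstar)
    -- the accuracy, the level of smoothing and the smoothed part of the objective
    (ε : ℝ) (hε : 0 < ε) (μ : ℝ) (hμ : μ = ε / D)
    (f : E₁ → ℝ) (hf : f = fun w => AccGrad.smoothedFenchelOn Q₂ g d₂ μ (A w)) :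
    -- the method is applicable to `J_μ = Ω + f`
    AccGrad.IsLcgOn Set.univ (‖A‖ ^ 2 * D / (σ₂ * ε)) f ∧
    (∀ L : ℝ, 0 < L → ∀ u₀ ∈ Q₁, DifferentiableAt ℝ d₁ u₀ →
      ∃ (w z u : ℕ → E₁) (a S : ℕ → ℝ),
        AccGrad.IsAGMRun Q₁ d₁ f Ω σ₁ L 0 lam w z u a S ∧ w 0 = u₀) ∧
    -- and gives a `2ε`-accurate solution of `J` within the stated number of steps
    (∀ L : ℝ, 0 < L → L ≤ ‖A‖ ^ 2 * D / (σ₂ * ε) → AccGrad.IsLcgOn Q₁ L f →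
      ∀ (w z u : ℕ → E₁) (a S : ℕ → ℝ),
        AccGrad.IsAGMRun Q₁ d₁ f Ω σ₁ L 0 lam w z u a S → DifferentiableAt ℝ d₁ (w 0) →
      ∀ k : ℕ, 1 ≤ k →
        AccGrad.iterationBound ε D ‖A‖ σ₁ σ₂ lam (AccGrad.bregman d₁ wstar (w 0)) ≤ (k : ℝ) →
        AccGrad.IsAccurateSolution Q₁ J (2 * ε) (w k)) := by
  have hne : Q₂.Nonempty := by
    obtain ⟨α, hα, -⟩ := hd₂min.1
    exact ⟨α, hα⟩
  have hD' : ∀ α ∈ Q₂, d₂ α ≤ D := fun α hα => hD.2 ⟨α, hα, rfl⟩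
  have h0' : ∀ α ∈ Q₂, 0 ≤ d₂ α := fun α hα => hd₂min.2 ⟨α, hα, rfl⟩
  have hbdd := AccGrad.StrongConvexOn.isBounded_of_le hd₂ hσ₂ hd₂min hD'
  have hcomp : IsCompact Q₂ := Metric.isCompact_of_isClosed_isBounded hQ₂ hbdd
  obtain ⟨B, hB⟩ := AccGrad.ConvexOn.exists_forall_le_of_isBounded hg hne hbdd
  have hμ0 : 0 < μ := by rw [hμ]; positivity
  have hμD : μ * D = ε := by rw [hμ]; field_simp
  set G : E₂ → ℝ := fun α => g α + μ * d₂ α with hG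
  have hGsc : StrongConvexOn Q₂ (μ * σ₂) G :=
    AccGrad.strongConvexOn_comb hd₂ hg hμ0.le zero_le_one 0 0 fun α => by
      simp only [hG, zero_apply]; ring
  have hGle : ∀ α ∈ Q₂, G α ≤ g α + ε := fun α hα => by
    have := mul_le_mul_of_nonneg_left (hD' α hα) hμ0.le
    simp only [hG]; linarith
  have hleG : ∀ α ∈ Q₂, g α ≤ G α + 0 := fun α hα => by
    have := mul_nonneg hμ0.le (h0' α hα)
    simp only [hG]; linarith
  have hBG : ∀ α ∈ Q₂, B ≤ G α := fun α hα => by linarith [hB α hα, hleG α hα]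
  have hm : 0 < μ * σ₂ := by positivity
  obtain ⟨α, hlow, hup, hlip⟩ := AccGrad.exists_gradient_fenchelOn hcomp hne hm hGsc hBG
  have hfG : f = fun w => AccGrad.fenchelOn Q₂ G (A w) := hf
  obtain ⟨hlcg, hgrad⟩ := AccGrad.isLcgOn_comp hm hlow hup hlip A
  rw [← hfG] at hlcg hgrad
  have hgrad' : ∀ x y, f x + fderiv ℝ f x (y - x) ≤ f y := by
    intro x y
    have h := hgrad x y
    rwa [hfG] at h ⊢
  have hLμ : ‖A‖ ^ 2 * D / (σ₂ * ε) = ‖A‖ ^ 2 / (μ * σ₂) := by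
    rw [hμ]; field_simp
  have hh := hΩsc.convexOn_sub hd₁ hΩ hlam
  have hσ₁ := hd₁.modulus_pos
  have hupper : ∀ w, J w ≤ f w + Ω w + ε := fun w => by
    have := AccGrad.fenchelOn_le_add hne hGle (A w)
      (AccGrad.bddAbove_fenchelOn hcomp hBG (A w))
    rw [hJ, hfG]; linarith
  have hlower : ∀ w, f w + Ω w ≤ J w := fun w => by
    have := AccGrad.fenchelOn_le_add hne hleG (A w)
      (AccGrad.bddAbove_fenchelOn hcomp hB (A w))
    rw [hJ, hfG]; linarith
  refine ⟨hLμ ▸ hlcg, fun L hL u₀ hu₀ _ => AccGrad.exists_isAGMRun hQ₁ hd₁ hΩ hh hlam hL hu₀, ?_⟩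
  intro L hL hLle hfL w z u a S hrun hdiff k hk hbound
  have hQc := hd₁.strongConvex.1
  -- A positive `L` below `‖A‖² / (μ σ₂)` excludes `A = 0`, so the divisions by `‖A‖` are genuine.
  have hA : 0 < ‖A‖ ^ 2 := by
    have h1 := hL.trans_le hLle
    rw [hLμ, div_pos_iff_of_pos_right hm] at h1
    exact h1
  set T := AccGrad.bregman d₁ wstar (w 0) with hT
  have hT0 : 0 ≤ T := by
    have hdc : ConvexOn ℝ Q₁ d₁ := hd₁.strongConvex.convexOn fun r => by
      simp only [Pi.zero_apply]; positivity
    have := AccGrad.ConvexOn.fderiv_sub_le hdc hwstar hrun.x_zero_mem hdiff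
    rw [hT, AccGrad.bregman]; linarith
  set C := ‖A‖ ^ 2 * D / (σ₂ * ε) * σ₁⁻¹ with hC
  have hC0 : 0 < C := by positivity
  have e1 : 4 * D * ‖A‖ ^ 2 / (σ₁ * σ₂) * T = ε ^ 2 * (4 * C * (T / ε)) := by
    rw [hC]; field_simp
  have e2 : 4 * D * ‖A‖ ^ 2 / (σ₁ * σ₂ * ε ^ 2) * T = 4 * C * (T / ε) := by
    rw [hC]; field_simp
  have e3 : σ₁ * σ₂ * lam * ε / (4 * D * ‖A‖ ^ 2) = lam / (4 * C) := by
    rw [hC]; field_simp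
  have e4 : 1 / ε * √(ε ^ 2 * (4 * C * (T / ε))) = √(4 * C * (T / ε)) := by
    rw [Real.sqrt_mul (by positivity), Real.sqrt_sq hε.le]; field_simp
  -- Dropping the nonnegative term `a lam S` and enlarging `L` to the bound in `hLle` keeps the
  -- growth estimate uniform over all admissible `L`.
  have hroot : ∀ j, S (j + 1) * (lam * S j + 1) ≤ C * a (j + 1) ^ 2 := fun j => by
    have h1 := hrun.a_root j
    have h2 := mul_nonneg (mul_nonneg (hrun.a_pos j).le hlam) (hrun.S_nonneg j)
    have h3 : L * σ₁⁻¹ * a (j + 1) ^ 2 ≤ C * a (j + 1) ^ 2 :=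
      mul_le_mul_of_nonneg_right (mul_le_mul_of_nonneg_right hLle (inv_nonneg.2 hσ₁.le))
        (sq_nonneg _)
    rw [hrun.S_succ]
    linarith
  have hgrow : T / ε ≤ S k := by
    refine AccGrad.div_le_of_recursion hC0 hlam hrun.S_zero hrun.a_pos hrun.S_succ hroot hk
      (by positivity) ?_
    rw [AccGrad.iterationBound, e1, e2, e3, e4] at hbound
    split_ifs at hbound with hl
    · rcases min_le_iff.1 hbound with hb | hb
      · exact Or.inl hb
      · exact Or.inr ⟨hl, hb⟩
    · exact Or.inl hbound
  obtain ⟨j, rfl⟩ := Nat.exists_eq_add_of_le' hk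
  have hS0 := hrun.S_succ_pos j
  have hmain := hrun.mul_sub_le hσ₁ hL hlam hd₁.strongConvex hdiff hh hgrad' hfL (j + 1) hwstar
  rw [div_le_iff₀ hε] at hgrow
  -- `T ≤ S (j + 1) * ε` absorbs the Bregman term: one `ε` is optimization error, the other comes
  -- from smoothing in `hupper`.
  have hmain' : S (j + 1) * (f (w (j + 1)) + Ω (w (j + 1))) ≤
      S (j + 1) * (f wstar + Ω wstar + ε) := by linarith
  have hfin := le_of_mul_le_mul_left hmain' hS0
  refine ⟨hrun.x_mem hQc _, fun y hy => ?_⟩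
  have h1 := hupper (w (j + 1))
  have h2 := hlower wstar
  have h3 : J wstar ≤ J y := hmin hy
  linarith
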